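/- For an element $g$ of a group $G$ let $$t(g)=\{n\in\mathbb{Z}_{\ge 1} : (x_1gx_1^{-1})(x_2gx_2^{-1})\cdots(x_ngx_n^{-1})=1 \text{ for some } x_1,\dots,x_n\in G\}.$$ Call $g$ a generalized torsion element if $g\neq 1$ and $t(g)\neq\emptyset$; its generalized torsion order is then $\min t(g)$. Let $p<q$ be primes, let $a,b\ge 0$ be integers, let $K\subset S^3$ be a $(p^a,q^b)$-torus knot (trivial if $p^a=1$ or $q^b=1$), that is, the image under a self-homeomorphism of $S^3$ of the curve $\{(z^{p^a},z^{q^b})/\sqrt2 : z\in\mathbb{C},\ |z|=1\}\subset S^3\subset\mathbb{C}^2$, and let $G(K)=\pi_1(S^3\setminus K)$ be its knot group. Then for every $g\in G(K)$ with $g\neq 1$, every $n\in t(g)$ is divisible by $p$ or satisfies $n\ge q$; that is, $$t(g)\subset p\mathbb{N}\cup\mathbb{N}_{\ge q}.$$ In particular, $G(K)$ has no generalized torsion element whose generalized torsion order is less than $q$ and not divisible by $p$. -/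

import Mathlib

noncomputable section

namespace GenTorsion

section Group

variable {G : Type*} [Group G]

/-- The generalized torsion equation spectrum `t(g)`: the set of positive integers `n` such that
some product of `n` conjugates of `g` is trivial. -/
def eqnSpectrum (g : G) : Set ℕ :=
  {n | 0 < n ∧ ∃ x : Fin n → G, (List.ofFn fun i => x i * g * (x i)⁻¹).prod = 1}

/-- A generalized torsion element: a non-trivial element with a trivial product of conjugates. -/
def IsGeneralizedTorsion (g : G) : Prop :=
  g ≠ 1 ∧ (eqnSpectrum g).Nonempty

/-- The generalized torsion order `gord(g) = min t(g)`, equal to `∞` if `t(g)` is empty. -/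
def gord (g : G) : ℕ∞ :=
  ⨅ n ∈ eqnSpectrum g, (n : ℕ∞)

end Group

/-- The three-sphere, as the unit sphere of `ℂ²` with its Euclidean norm. -/
abbrev S3 : Type := Metric.sphere (0 : EuclideanSpace ℂ (Fin 2)) 1

/-- The closed curve `z ↦ (z ^ m, z ^ n) / √2` on the standard torus `|z₁| = |z₂|` in `S³`. -/
def torusCurve (m n : ℕ) (z : Circle) : S3 :=
  ⟨!₂[(z : ℂ) ^ m / (√2 : ℝ), (z : ℂ) ^ n / (√2 : ℝ)], by
    rw [mem_sphere_zero_iff_norm, EuclideanSpace.norm_eq, Fin.sum_univ_two]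
    norm_num [div_pow, Circle.norm_coe]⟩

/-- The standard `(m, n)`-torus knot (a knot when `m` and `n` are coprime). -/
def standardTorusKnot (m n : ℕ) : Set S3 :=
  Set.range (torusCurve m n)

/-- `K ⊆ S³` is an `(m, n)`-torus knot: some self-homeomorphism of `S³` (for instance the final
map of an ambient isotopy) carries the standard `(m, n)`-torus knot onto `K`. -/
def IsTorusKnot (m n : ℕ) (K : Set S3) : Prop :=
  ∃ h : S3 ≃ₜ S3, h '' standardTorusKnot m n = K

/-- The knot group `G(K) = π₁(S³ ∖ K, x₀)`. -/
abbrev KnotGroup (K : Set S3) (x₀ : (Kᶜ : Set S3)) : Type :=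
  FundamentalGroup (Kᶜ : Set S3) x₀

end GenTorsion

end

/-! Algebra. Let `G = ⟨x, y | x ^ m = y ^ n⟩` with `m * n = p ^ a * q ^ b`, let `φ : G → ℤ` send `x`
to `n` and `y` to `m`, and let `η` be a primitive root of unity of order `m * n`. Sending `x` to
`diag(1, η ^ n)` and `y` to `1 + (η ^ m - 1) E`, for a suitable idempotent matrix `E` over `ℂ[X]`,
defines a representation `ρ` on `ℂ[X]²` which at `X = 0` becomes `h ↦ diag(1, η ^ φ h)`. A degree
count on alternating words shows that the kernel of `ρ` consists of powers of `x`; as `φ x ≠ 0`, it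
meets the kernel of `φ` trivially.

Suppose that `g ≠ 1` and that the product of the `cᵢ g cᵢ⁻¹`, for `N` elements `cᵢ`, is trivial.
Then `φ g = 0`, so `ρ g = 1 + X ^ (k + 1) M` with `M(0) ≠ 0`, and the coefficient of `X ^ (k + 1)`
in the product says that the conjugates of `M(0)` by `diag(1, η ^ φ cᵢ)` sum to zero. A nonzero
entry of `M(0)` turns this into a vanishing sum of `N` powers of `η`. By the Lam–Leung argument such
a sum has `p ∣ N` as soon as `N < q` (`dvd_card_of_sum_roots_of_unity_eq_zero`).

Topology. The knot complement is a retract of an open cone in `ℂ²`, so its group embeds in that of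
the cone; this suffices, because `t(g)` can only grow under a homomorphism. The cone is covered by
two open sides, each with an explicit contractible covering space on which `ℤ` acts, and their
intersection is the image of a convex set of pairs of logarithms. Joining paths within the sides
gives two generators (`FundamentalGroup.eq_top_of_open_cover`), a loop in the intersection gives the
relation, and the universal property comes from the monodromy of an explicit Čech cocycle
(`exists_hom_of_cech`). -/

/-! ### Vanishing sums of roots of unity -/

open Polynomial in
/-- If a sum of `p ^ a`-th roots of unity vanishes, then the number of terms is divisible by `p`. -/
theorem dvd_card_of_sum_primePow_roots_eq_zero {p a : ℕ} (hp : p.Prime) {ξ : ℂ}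
    (hξ : IsPrimitiveRoot ξ (p ^ a)) {ι : Type*} (S : Finset ι) (e : ι → ℕ)
    (h : ∑ i ∈ S, ξ ^ e i = 0) : p ∣ S.card := by
  have := Fact.mk hp
  rcases a with _ | k
  · have h1 : ξ = 1 := by simpa using hξ
    subst h1
    have : S.card = 0 := by
      simpa using h
    rw [this]; exact dvd_zero p
  -- The cyclotomic polynomial of prime power order takes the value `p` at `1`, whereas the sum of
  -- monomials takes the number of terms.
  · have hdvd : cyclotomic (p ^ (k + 1)) ℤ ∣ ∑ i ∈ S, (X : ℤ[X]) ^ e i := by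
      rw [cyclotomic_eq_minpoly hξ (pow_pos hp.pos _)]
      apply minpoly.isIntegrallyClosed_dvd (hξ.isIntegral (pow_pos hp.pos _))
      simpa using h
    have h2 := eval_dvd (x := 1) hdvd
    rw [eval_one_cyclotomic_prime_pow] at h2
    simp only [eval_finsetSum, eval_pow, eval_X, one_pow, Finset.sum_const, nsmul_eq_mul,
      mul_one] at h2
    exact_mod_cast h2

open Polynomial in
/-- A vanishing integer combination of powers of a primitive root of unity vanishes at all
primitive roots of unity of the same order. -/
theorem sum_pow_eq_zero_of_isPrimitiveRoot {N : ℕ} (hN : 0 < N) {η η' : ℂ}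
    (hη : IsPrimitiveRoot η N) (hη' : IsPrimitiveRoot η' N) {ι : Type*} (S : Finset ι)
    (e : ι → ℕ) (h : ∑ i ∈ S, η ^ e i = 0) : ∑ i ∈ S, η' ^ e i = 0 := by
  have hdvd : cyclotomic N ℤ ∣ ∑ i ∈ S, (X : ℤ[X]) ^ e i := by
    rw [cyclotomic_eq_minpoly hη hN]
    apply minpoly.isIntegrallyClosed_dvd (hη.isIntegral hN)
    simpa using h
  obtain ⟨g, hg⟩ := hdvd
  have h2 := congrArg (aeval η') hg
  rw [map_mul, cyclotomic_eq_minpoly hη' hN, minpoly.aeval, zero_mul] at h2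
  simpa using h2

open Polynomial in
/-- A polynomial of degree less than `q ^ (k + 1)` which vanishes at the primitive
`q ^ (k + 1)`-th roots of unity has coefficients that are `q ^ k`-periodic. -/
theorem coeff_eq_of_primitiveRoots_isRoot {q k : ℕ} (hq : q.Prime) {F : ℂ[X]}
    (hdeg : F.natDegree < q ^ (k + 1))
    (hF : ∀ ζ : ℂ, IsPrimitiveRoot ζ (q ^ (k + 1)) → F.eval ζ = 0) {c j : ℕ}
    (hc : c < q ^ k) (hj : j < q) : F.coeff (c + j * q ^ k) = F.coeff c := by
  have := Fact.mk hq
  have hpos : 0 < q ^ (k + 1) := pow_pos hq.pos _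
  have hprim := Complex.isPrimitiveRoot_exp (q ^ (k + 1)) hpos.ne'
  -- The coefficients of `F` need not be rational, so divisibility has to come from all the linear
  -- factors, not from one root and its minimal polynomial.
  have hdvd : cyclotomic (q ^ (k + 1)) ℂ ∣ F := by
    rw [cyclotomic_eq_prod_X_sub_primitiveRoots hprim]
    apply Finset.prod_dvd_of_coprime
    · intro x _ y _ hxy
      exact pairwise_coprime_X_sub_C Function.injective_id hxy
    · intro ζ hζ
      rw [dvd_iff_isRoot]
      exact hF ζ ((mem_primitiveRoots hpos).1 hζ)
  obtain ⟨H, rfl⟩ := hdvd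
  rcases eq_or_ne H 0 with rfl | hH
  · simp
  have hH' : H.natDegree < q ^ k := by
    rw [natDegree_mul (cyclotomic_ne_zero _ _) hH, natDegree_cyclotomic,
      Nat.totient_prime_pow_succ hq] at hdeg
    have : q ^ (k + 1) = q ^ k * (q - 1) + q ^ k := by
      rw [pow_succ, Nat.mul_sub, mul_one, Nat.sub_add_cancel]
      exact Nat.le_mul_of_pos_right _ hq.pos
    omega
  -- Here `F = (1 + X ^ (q ^ k) + ⋯ + X ^ ((q - 1) * q ^ k)) * H` with `deg H < q ^ k`: the shifted
  -- copies of `H` do not overlap, so `F` is `q` repetitions of the coefficients of `H`.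
  have key : ∀ i < q, (cyclotomic (q ^ (k + 1)) ℂ * H).coeff (c + i * q ^ k) = H.coeff c := by
    intro i hi
    rw [cyclotomic_prime_pow_eq_geom_sum hq, Finset.sum_mul, finsetSum_coeff]
    rw [Finset.sum_eq_single i]
    · rw [← pow_mul, mul_comm (q ^ k) i, mul_comm, coeff_mul_X_pow]
    · intro b _ hbi
      rw [← pow_mul, mul_comm, coeff_mul_X_pow']
      split_ifs with hle
      · apply coeff_eq_zero_of_natDegree_lt
        refine hH'.trans_le ?_
        rcases lt_or_gt_of_ne hbi with hlt | hlt
        · have : (b + 1) * q ^ k ≤ i * q ^ k := Nat.mul_le_mul_right _ hlt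
          rw [add_mul, one_mul] at this
          rw [mul_comm (q ^ k) b]
          omega
        · exfalso
          have : (i + 1) * q ^ k ≤ b * q ^ k := Nat.mul_le_mul_right _ hlt
          rw [add_mul, one_mul] at this
          rw [mul_comm (q ^ k) b] at hle
          omega
      · rfl
    · intro hi'
      exact absurd (Finset.mem_range.2 hi) hi'
  rw [key j hj]
  simpa using (key 0 hq.pos).symm

open Polynomial in
/-- A special case of the Lam–Leung theorem: a vanishing sum of fewer than `q` roots of unity of
order dividing `p ^ a * q ^ b` has a number of terms divisible by `p`. -/
theorem dvd_card_of_sum_roots_of_unity_eq_zero {p q a b : ℕ} (hp : p.Prime) (hq : q.Prime)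
    (hpq : p ≠ q) {η : ℂ} (hη : IsPrimitiveRoot η (p ^ a * q ^ b)) {ι : Type*} [Fintype ι]
    (hcard : Fintype.card ι < q) (e : ι → ℤ) (h : ∑ i, η ^ e i = 0) : p ∣ Fintype.card ι := by
  classical
  have hN : 0 < p ^ a * q ^ b := Nat.mul_pos (pow_pos hp.pos _) (pow_pos hq.pos _)
  have hnat : ∃ e' : ι → ℕ, ∑ i, η ^ e' i = 0 := by
    refine ⟨fun i => (e i % (p ^ a * q ^ b : ℕ)).toNat, ?_⟩
    rw [← h]
    refine Finset.sum_congr rfl fun i _ => ?_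
    rw [← zpow_natCast, Int.toNat_of_nonneg (Int.emod_nonneg _ (by exact_mod_cast hN.ne'))]
    have h0 : η ≠ 0 := hη.ne_zero hN.ne'
    conv_rhs => rw [← Int.emod_add_mul_ediv (e i) (p ^ a * q ^ b : ℕ), zpow_add₀ h0, zpow_mul,
      zpow_natCast, hη.pow_eq_one, one_zpow, mul_one]
  obtain ⟨e, h⟩ := hnat
  have hξ := Complex.isPrimitiveRoot_exp (p ^ a) (pow_pos hp.pos _).ne'
  set ξ := Complex.exp (2 * Real.pi * Complex.I / (p ^ a : ℕ)) with hξdef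
  -- By Galois conjugation `η` may be replaced by `ξ * ζ`, with `ξ` fixed of order `p ^ a` and `ζ`
  -- any primitive root of order `q ^ b`.
  have hall : ∀ ζ : ℂ, IsPrimitiveRoot ζ (q ^ b) → ∑ i, (ξ * ζ) ^ e i = 0 := by
    intro ζ hζ
    refine sum_pow_eq_zero_of_isPrimitiveRoot hN hη ?_ Finset.univ e h
    have hco : Nat.Coprime (orderOf ξ) (orderOf ζ) := by
      rw [← hξ.eq_orderOf, ← hζ.eq_orderOf]
      exact Nat.coprime_pow_primes _ _ hp hq hpq
    have := (Commute.all ξ ζ).orderOf_mul_eq_mul_orderOf_of_coprime hco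
    rw [← hξ.eq_orderOf, ← hζ.eq_orderOf] at this
    rw [← this]
    exact IsPrimitiveRoot.orderOf _
  rcases b with _ | k
  · have := hall 1 (by simp)
    simp only [mul_one] at this
    exact dvd_card_of_sum_primePow_roots_eq_zero hp hξ Finset.univ e this
  have hQ : 0 < q ^ (k + 1) := pow_pos hq.pos _
  set F : ℂ[X] := ∑ i, C (ξ ^ e i) * X ^ (e i % q ^ (k + 1)) with hF
  have hdeg : F.natDegree < q ^ (k + 1) := by
    have : F.natDegree ≤ q ^ (k + 1) - 1 := by
      refine natDegree_sum_le_of_forall_le _ _ fun i _ => ?_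
      refine (natDegree_C_mul_X_pow_le _ _).trans ?_
      have := Nat.mod_lt (e i) hQ
      omega
    omega
  have hroot : ∀ ζ : ℂ, IsPrimitiveRoot ζ (q ^ (k + 1)) → F.eval ζ = 0 := by
    intro ζ hζ
    rw [← hall ζ hζ, hF, eval_finsetSum]
    refine Finset.sum_congr rfl fun i _ => ?_
    rw [eval_mul, eval_C, eval_pow, eval_X, mul_pow]
    congr 1
    conv_rhs => rw [← Nat.mod_add_div (e i) (q ^ (k + 1)), pow_add, pow_mul, hζ.pow_eq_one,
      one_pow, mul_one]
  have hcoeff : ∀ c, F.coeff c =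
      ∑ i ∈ Finset.univ.filter (fun i => e i % q ^ (k + 1) = c), ξ ^ e i := by
    intro c
    rw [hF, finsetSum_coeff, Finset.sum_filter]
    refine Finset.sum_congr rfl fun i _ => ?_
    rw [coeff_C_mul_X_pow]
    simp only [eq_comm]
  have hzero : ∀ c < q ^ (k + 1), F.coeff c = 0 := by
    intro c hc
    have hqk : 0 < q ^ k := pow_pos hq.pos _
    set r := c % q ^ k with hr
    have hrlt : r < q ^ k := Nat.mod_lt _ hqk
    have hrc : ∀ j < q, F.coeff (r + j * q ^ k) = F.coeff r := fun j hj =>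
      coeff_eq_of_primitiveRoots_isRoot hq hdeg hroot hrlt hj
    have hcr : F.coeff c = F.coeff r := by
      have := hrc (c / q ^ k) (by rw [Nat.div_lt_iff_lt_mul hqk, mul_comm]; rwa [pow_succ] at hc)
      rwa [hr, mul_comm, Nat.mod_add_div] at this
    rw [hcr]
    by_contra hne
    -- A nonzero coefficient would be repeated at `q` different exponents, each of which needs its
    -- own term of the sum; there are fewer than `q` terms.
    have hex : ∀ j : Fin q, ∃ i, e i % q ^ (k + 1) = r + j * q ^ k := by
      intro j
      by_contra! hno
      apply hne
      rw [← hrc j j.2, hcoeff, Finset.filter_false_of_mem (fun i _ => hno i), Finset.sum_empty]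
    choose f hf using hex
    have hinj : Function.Injective f := by
      intro j j' hjj
      have h1 := hf j
      rw [hjj, hf j'] at h1
      have h2 : (j' : ℕ) * q ^ k = j * q ^ k := by omega
      exact Fin.ext (Nat.eq_of_mul_eq_mul_right hqk h2).symm
    have := Fintype.card_le_of_injective f hinj
    rw [Fintype.card_fin] at this
    omega
  -- Grouping the terms by exponent modulo `q ^ (k + 1)`, each group is a vanishing sum of roots of
  -- unity of order dividing `p ^ a`.
  have hsum : Fintype.card ι = ∑ c ∈ Finset.range (q ^ (k + 1)),
      (Finset.univ.filter (fun i => e i % q ^ (k + 1) = c)).card := by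
    rw [← Finset.card_univ]
    exact Finset.card_eq_sum_card_fiberwise fun i _ =>
      Finset.mem_coe.2 (Finset.mem_range.2 (Nat.mod_lt _ hQ))
  rw [hsum]
  refine Finset.dvd_sum fun c hc => ?_
  refine dvd_card_of_sum_primePow_roots_eq_zero hp hξ _ e ?_
  rw [← hcoeff, hzero c (Finset.mem_range.1 hc)]

/-! ### Normal forms for `x ^ m = y ^ n` -/

namespace TorusGroup

section NormalForm

variable {G : Type*} [Group G]

/-- Alternating words `y ^ j₁ * x ^ i₁ * ⋯ * y ^ jᵣ * x ^ iᵣ` with `r ≥ 1`, where no exponent of `y`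
is divisible by `n` and no exponent of `x`, except possibly the last, is divisible by `m`. -/
inductive IsAlternating (x y : G) (m n : ℕ) : G → Prop
  | base (j i : ℤ) (hj : ¬ (n : ℤ) ∣ j) : IsAlternating x y m n (y ^ j * x ^ i)
  | step (j i : ℤ) (hj : ¬ (n : ℤ) ∣ j) (hi : ¬ (m : ℤ) ∣ i) (h : G)
      (hh : IsAlternating x y m n h) : IsAlternating x y m n (y ^ j * (x ^ i * h))

/-- Elements of the form `x ^ i` or `x ^ i * h` with `h` alternating. -/
def IsNormalForm (x y : G) (m n : ℕ) (g : G) : Prop :=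
  ∃ i : ℤ, g = x ^ i ∨ ∃ h, IsAlternating x y m n h ∧ g = x ^ i * h

variable {x y : G} {m n : ℕ}

theorem IsNormalForm.zpow_mul {g : G} (hg : IsNormalForm x y m n g) (k : ℤ) :
    IsNormalForm x y m n (x ^ k * g) := by
  obtain ⟨i, rfl | ⟨h, hh, rfl⟩⟩ := hg
  · exact ⟨k + i, Or.inl (zpow_add _ _ _).symm⟩
  · exact ⟨k + i, Or.inr ⟨h, hh, by rw [zpow_add, mul_assoc]⟩⟩

theorem IsAlternating.isNormalForm {h : G} (hh : IsAlternating x y m n h) :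
    IsNormalForm x y m n h :=
  ⟨0, Or.inr ⟨h, hh, by simp⟩⟩

theorem zpow_mul_eq_zpow_mul (hrel : x ^ m = y ^ n) (k : ℤ) :
    x ^ ((m : ℤ) * k) = y ^ ((n : ℤ) * k) := by
  rw [zpow_mul, zpow_mul, zpow_natCast, zpow_natCast, hrel]

theorem IsNormalForm.zpow_mul_zpow (hrel : x ^ m = y ^ n) (j i : ℤ) :
    IsNormalForm x y m n (y ^ j * x ^ i) := by
  by_cases hj : (n : ℤ) ∣ j
  · obtain ⟨k, rfl⟩ := hj
    rw [← zpow_mul_eq_zpow_mul hrel]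
    exact IsNormalForm.zpow_mul ⟨i, Or.inl rfl⟩ _
  · exact (IsAlternating.base j i hj).isNormalForm

/-- The common power `x ^ m = y ^ n` lets an exponent divisible by `m` or `n` change letter. If the
`x`-power in front of `h` is such, it merges with `y ^ j` and with the first `y`-power of `h`; if
the merged exponent is divisible by `n`, it passes on into the next `x`-power, and the word becomes
shorter. -/
theorem IsNormalForm.zpow_right_mul (hrel : x ^ m = y ^ n) {g : G}
    (hg : IsNormalForm x y m n g) (j : ℤ) : IsNormalForm x y m n (y ^ j * g) := by
  obtain ⟨i, rfl | ⟨h, hh, rfl⟩⟩ := hg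
  · exact .zpow_mul_zpow hrel j i
  by_cases hj : (n : ℤ) ∣ j
  · obtain ⟨k, rfl⟩ := hj
    rw [← zpow_mul_eq_zpow_mul hrel]
    exact (hh.isNormalForm.zpow_mul i).zpow_mul _
  by_cases hi : (m : ℤ) ∣ i
  · obtain ⟨k, rfl⟩ := hi
    rw [zpow_mul_eq_zpow_mul hrel, ← mul_assoc, ← zpow_add]
    cases hh with
    | base j' i' hj' =>
      rw [← mul_assoc, ← zpow_add]
      exact .zpow_mul_zpow hrel _ _
    | step j' i' hj' hi' h' hh' =>
      rw [← mul_assoc, ← zpow_add]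
      by_cases hd : (n : ℤ) ∣ j + n * k + j'
      · obtain ⟨l, hl⟩ := hd
        rw [hl, ← zpow_mul_eq_zpow_mul hrel]
        exact (hh'.isNormalForm.zpow_mul i').zpow_mul _
      · exact (IsAlternating.step _ _ hd hi' _ hh').isNormalForm
  · exact (IsAlternating.step _ _ hj hi _ hh).isNormalForm

theorem isNormalForm_of_closure_eq_top (hgen : Subgroup.closure {x, y} = ⊤)
    (hrel : x ^ m = y ^ n) (g : G) : IsNormalForm x y m n g := by
  have hg : g ∈ Subgroup.closure {x, y} := hgen ▸ Subgroup.mem_top g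
  induction hg using Subgroup.closure_induction_left with
  | one => exact ⟨0, Or.inl (by simp)⟩
  | mul_left a ha b _ ih =>
    rcases ha with rfl | rfl
    · simpa using ih.zpow_mul 1
    · simpa using ih.zpow_right_mul hrel 1
  | inv_mul_cancel a ha b _ ih =>
    rcases ha with rfl | rfl
    · simpa using ih.zpow_mul (-1)
    · simpa using ih.zpow_right_mul hrel (-1)

end NormalForm

/-! ### A representation over `ℂ[X]` and its kernel -/

section Representation

open Polynomial Matrix

/-- The one-parameter subgroup `a ↦ diag(1, a)`. -/
noncomputable def diagHom : ℂ →* Matrix (Fin 2) (Fin 2) ℂ[X] where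
  toFun a := !![1, 0; 0, C a]
  map_one' := by ext i j; fin_cases i <;> fin_cases j <;> simp
  map_mul' a b := by ext i j; fin_cases i <;> fin_cases j <;> simp

/-- The one-parameter subgroup `b ↦ 1 + (b - 1) E`, where `E` is the idempotent with rows
`(X ^ 2, X * (1 - X ^ 2))` and `(X, 1 - X ^ 2)`. -/
noncomputable def shearHom : ℂ →* Matrix (Fin 2) (Fin 2) ℂ[X] where
  toFun b := !![1 + (C b - 1) * X ^ 2, (C b - 1) * (X * (1 - X ^ 2));
    (C b - 1) * X, 1 + (C b - 1) * (1 - X ^ 2)]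
  map_one' := by ext i j; fin_cases i <;> fin_cases j <;> simp
  map_mul' a b := by
    refine Matrix.ext fun i j => ?_
    fin_cases i <;> fin_cases j <;> simp [Matrix.mul_apply, Fin.sum_univ_two] <;> ring

/-- The entries of `v` have degrees `d + 1` and `d` and the same leading coefficient `c`. -/
structure HasLead (v : Fin 2 → ℂ[X]) (d : ℕ) (c : ℂ) : Prop where
  coeff_zero : (v 0).coeff (d + 1) = c
  coeff_one : (v 1).coeff d = c
  high_zero : ∀ k, d + 1 < k → (v 0).coeff k = 0
  high_one : ∀ k, d < k → (v 1).coeff k = 0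

theorem diagHom_mulVec (a : ℂ) (v : Fin 2 → ℂ[X]) :
    diagHom a *ᵥ v = ![v 0, C a * v 1] := by
  ext i : 1
  fin_cases i <;> simp [diagHom, Matrix.mulVec, dotProduct, Fin.sum_univ_two]

theorem shearHom_mulVec (b : ℂ) (v : Fin 2 → ℂ[X]) :
    shearHom b *ᵥ v = ![v 0 + C (b - 1) * (X ^ 2 * v 0 + X ^ 1 * v 1 - X ^ 3 * v 1),
      v 1 + C (b - 1) * (X ^ 1 * v 0 + v 1 - X ^ 2 * v 1)] := by
  ext i : 1
  fin_cases i <;> simp [shearHom, Matrix.mulVec, dotProduct, Fin.sum_univ_two] <;> ring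

/-- The idempotent is the column `(X, 1)` times the row `(X, 1 - X ^ 2)`. So the shear adds to a
vector a multiple of `(X, 1)`, and after `diag(1, a)` the row takes the value `(1 - a) * c * X ^ (d
+ 2)` plus lower terms, as the two top contributions `c` and `-a * c` meet in the same degree. The
new term dominates the old vector. -/
theorem HasLead.step {v : Fin 2 → ℂ[X]} {d : ℕ} {c : ℂ} (hv : HasLead v d c) (a b : ℂ) :
    HasLead (shearHom b *ᵥ (diagHom a *ᵥ v)) (d + 2) ((b - 1) * ((1 - a) * c)) := by
  rw [diagHom_mulVec, shearHom_mulVec]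
  have h0 : ∀ l, (X ^ 2 * v 0).coeff (l + 3) = (v 0).coeff (l + 1) :=
    fun l => coeff_X_pow_mul _ 2 (l + 1)
  have h1 : ∀ l, (X ^ 1 * (C a * v 1)).coeff (l + 3) = a * (v 1).coeff (l + 2) := fun l => by
    rw [← coeff_C_mul]; exact coeff_X_pow_mul _ 1 (l + 2)
  have h2 : ∀ l, (X ^ 3 * (C a * v 1)).coeff (l + 3) = a * (v 1).coeff l := fun l => by
    rw [← coeff_C_mul]; exact coeff_X_pow_mul _ 3 l
  have h3 : ∀ l, (X ^ 1 * v 0).coeff (l + 2) = (v 0).coeff (l + 1) :=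
    fun l => coeff_X_pow_mul _ 1 (l + 1)
  have h4 : ∀ l, (X ^ 2 * (C a * v 1)).coeff (l + 2) = a * (v 1).coeff l := fun l => by
    rw [← coeff_C_mul]; exact coeff_X_pow_mul _ 2 l
  constructor
  · simp only [cons_val_zero, cons_val_one, coeff_add, coeff_sub, coeff_C_mul]
    rw [h0, h1, h2, hv.high_zero (d + 2 + 1) (by omega), hv.high_one (d + 2) (by omega),
      hv.coeff_zero, hv.coeff_one]
    ring
  · simp only [cons_val_zero, cons_val_one, coeff_add, coeff_sub, coeff_C_mul]
    rw [h3, h4, hv.high_one (d + 2) (by omega), hv.coeff_zero, hv.coeff_one]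
    ring
  · intro k hk
    obtain ⟨l, rfl⟩ : ∃ l, k = l + 3 := ⟨k - 3, by omega⟩
    simp only [cons_val_zero, cons_val_one, coeff_add, coeff_sub, coeff_C_mul]
    rw [h0, h1, h2, hv.high_zero (l + 3) (by omega), hv.high_zero (l + 1) (by omega),
      hv.high_one (l + 2) (by omega), hv.high_one l (by omega)]
    ring
  · intro k hk
    obtain ⟨l, rfl⟩ : ∃ l, k = l + 2 := ⟨k - 2, by omega⟩
    simp only [cons_val_zero, cons_val_one, coeff_add, coeff_sub, coeff_C_mul]
    rw [h3, h4, hv.high_zero (l + 1) (by omega), hv.high_one (l + 2) (by omega),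
      hv.high_one l (by omega)]
    ring

theorem hasLead_base (a b : ℂ) :
    HasLead (shearHom b *ᵥ (diagHom a *ᵥ ![1, 0])) 1 (b - 1) := by
  rw [diagHom_mulVec, shearHom_mulVec]
  generalize b - 1 = e
  constructor
  · simp [coeff_one, coeff_X_pow]
  · simp
  · intro k hk
    have : k ≠ 0 := by omega
    have h2 : k ≠ 2 := by omega
    simp [coeff_one, coeff_X_pow, this, h2]
  · intro k hk
    have h2 : 1 ≠ k := by omega
    simp [coeff_X, h2]

theorem exists_hasLead_of_isAlternating {G : Type*} [Group G] {x y : G} {m n : ℕ}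
    {ρ : G →* (Matrix (Fin 2) (Fin 2) ℂ[X])ˣ} {ζ ω : ℂˣ}
    (hx : ρ x = Units.map diagHom ζ) (hy : ρ y = Units.map shearHom ω)
    (hζ : ∀ i : ℤ, ζ ^ i = 1 → (m : ℤ) ∣ i) (hω : ∀ j : ℤ, ω ^ j = 1 → (n : ℤ) ∣ j) {h : G}
    (hh : IsAlternating x y m n h) :
    ∃ d c, c ≠ 0 ∧ HasLead ((ρ h : Matrix (Fin 2) (Fin 2) ℂ[X]) *ᵥ ![1, 0]) d c := by
  have hxi : ∀ i : ℤ, (ρ (x ^ i) : Matrix (Fin 2) (Fin 2) ℂ[X]) = diagHom ((ζ ^ i : ℂˣ) : ℂ) := by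
    intro i
    rw [map_zpow, hx, ← map_zpow]; rfl
  have hyj : ∀ j : ℤ, (ρ (y ^ j) : Matrix (Fin 2) (Fin 2) ℂ[X]) = shearHom ((ω ^ j : ℂˣ) : ℂ) := by
    intro j
    rw [map_zpow, hy, ← map_zpow]; rfl
  have hω' : ∀ j : ℤ, ¬ (n : ℤ) ∣ j → ((ω ^ j : ℂˣ) : ℂ) - 1 ≠ 0 := fun j hj h0 =>
    hj (hω j (Units.ext (sub_eq_zero.1 h0)))
  have hζ' : ∀ i : ℤ, ¬ (m : ℤ) ∣ i → 1 - ((ζ ^ i : ℂˣ) : ℂ) ≠ 0 := fun i hi h0 =>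
    hi (hζ i (Units.ext (sub_eq_zero.1 h0).symm))
  induction hh with
  | base j i hj =>
    refine ⟨1, _, hω' j hj, ?_⟩
    rw [map_mul, Units.val_mul, hxi, hyj, ← Matrix.mulVec_mulVec]
    exact hasLead_base _ _
  | step j i hj hi h _ ih =>
    obtain ⟨d, c, hc, hl⟩ := ih
    refine ⟨d + 2, _, mul_ne_zero (hω' j hj) (mul_ne_zero (hζ' i hi) hc), ?_⟩
    rw [map_mul, map_mul, Units.val_mul, Units.val_mul, hxi, hyj, ← Matrix.mulVec_mulVec,
      ← Matrix.mulVec_mulVec]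
    exact hl.step _ _

/-- The powers of `x` fix the first basis vector, but an alternating word gives it a nonzero second
coordinate, which a further power of `x` only rescales. Hence no alternating part can occur in `g`.
-/
theorem exists_eq_zpow_of_rho_eq_one {G : Type*} [Group G] {x y : G} {m n : ℕ}
    (hgen : Subgroup.closure {x, y} = ⊤) (hrel : x ^ m = y ^ n)
    {ρ : G →* (Matrix (Fin 2) (Fin 2) ℂ[X])ˣ} {ζ ω : ℂˣ}
    (hx : ρ x = Units.map diagHom ζ) (hy : ρ y = Units.map shearHom ω)
    (hζ : ∀ i : ℤ, ζ ^ i = 1 → (m : ℤ) ∣ i) (hω : ∀ j : ℤ, ω ^ j = 1 → (n : ℤ) ∣ j) {g : G}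
    (hg : ρ g = 1) : ∃ i : ℤ, g = x ^ i := by
  obtain ⟨i, h | ⟨h, hh, rfl⟩⟩ := isNormalForm_of_closure_eq_top hgen hrel g
  · exact ⟨i, h⟩
  exfalso
  obtain ⟨d, c, hc, hl⟩ := exists_hasLead_of_isAlternating hx hy hζ hω hh
  have h1 : (ρ (x ^ i * h) : Matrix (Fin 2) (Fin 2) ℂ[X]) *ᵥ ![1, 0] = ![1, 0] := by
    rw [hg, Units.val_one, Matrix.one_mulVec]
  rw [map_mul, map_zpow, hx, ← map_zpow, Units.val_mul, ← Matrix.mulVec_mulVec, Units.coe_map,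
    diagHom_mulVec] at h1
  have h2 := congrArg (fun v : Fin 2 → ℂ[X] => (v 1).coeff d) h1
  simp only [cons_val_one, coeff_C_mul, cons_val_fin_one, coeff_zero] at h2
  rw [hl.coeff_one] at h2
  exact mul_ne_zero (Units.ne_zero _) hc h2

end Representation

/-! ### The lowest order term of a product of conjugates -/

section Expansion

open Polynomial Matrix

theorem exists_eq_X_pow_smul {ι : Type*} [Finite ι] (M : Matrix ι ι ℂ[X]) (hM : M ≠ 0)
    (h0 : ∀ i j, (M i j).coeff 0 = 0) :
    ∃ (k : ℕ) (M' : Matrix ι ι ℂ[X]), M = (X ^ (k + 1) : ℂ[X]) • M' ∧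
      ∃ i j, (M' i j).eval 0 ≠ 0 := by
  classical
  have hex : ∃ k, ∃ i j, (M i j).coeff k ≠ 0 := by
    by_contra! hno
    exact hM (Matrix.ext fun i j => Polynomial.ext fun k => by simpa using hno k i j)
  -- `Nat.find hex` is the order of vanishing of `M` at `X = 0`, which is positive by `h0`.
  obtain ⟨k, hk⟩ : ∃ k, Nat.find hex = k + 1 := Nat.exists_eq_succ_of_ne_zero fun h => by
    obtain ⟨i, j, hij⟩ := Nat.find_spec hex
    rw [h] at hij
    exact hij (h0 i j)
  have hdvd : ∀ i j, (X ^ (k + 1) : ℂ[X]) ∣ M i j := fun i j => by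
    rw [X_pow_dvd_iff]
    intro d hd
    by_contra hne
    exact Nat.find_min hex (hk ▸ hd) ⟨i, j, hne⟩
  choose M' hM' using hdvd
  refine ⟨k, Matrix.of M', Matrix.ext fun i j => by simpa using hM' i j, ?_⟩
  obtain ⟨i, j, hij⟩ := Nat.find_spec hex
  refine ⟨i, j, fun h => hij ?_⟩
  rw [hk, hM', coeff_X_pow_mul', if_pos le_rfl, Nat.sub_self, coeff_zero_eq_eval_zero]
  exact h

/-- Cross terms carry `X ^ (2 * (k + 1))`, hence vanish modulo `X ^ (k + 2)`; this is why the
exponent is taken to be at least one. -/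
theorem exists_prod_one_add_X_pow_smul {ι : Type*} [Fintype ι] [DecidableEq ι] (k : ℕ)
    (l : List (Matrix ι ι ℂ[X])) :
    ∃ Z : Matrix ι ι ℂ[X], (l.map fun M => 1 + (X ^ (k + 1) : ℂ[X]) • M).prod =
      1 + (X ^ (k + 1) : ℂ[X]) • (l.sum + (X : ℂ[X]) • Z) := by
  induction l with
  | nil => exact ⟨0, by simp⟩
  | cons M l ih =>
    obtain ⟨Z, hZ⟩ := ih
    refine ⟨Z + (X ^ k : ℂ[X]) • (M * (l.sum + (X : ℂ[X]) • Z)), ?_⟩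
    rw [List.map_cons, List.prod_cons, hZ, List.sum_cons]
    have e : M + l.sum + (X : ℂ[X]) • (Z + (X ^ k : ℂ[X]) • (M * (l.sum + (X : ℂ[X]) • Z))) =
        M + (l.sum + (X : ℂ[X]) • Z) +
          (X ^ (k + 1) : ℂ[X]) • (M * (l.sum + (X : ℂ[X]) • Z)) := by
      rw [smul_add, smul_smul, ← pow_succ', add_assoc, add_assoc, add_assoc]
    rw [e]
    generalize l.sum + (X : ℂ[X]) • Z = W
    rw [add_mul, one_mul, mul_add, mul_one, smul_mul_assoc, mul_smul_comm, smul_add, smul_add]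
    abel

/-- If a product of conjugates of `1 + X ^ (k + 1) • M` is trivial, then the sum of the conjugates
of `M` vanishes at `X = 0`. -/
theorem sum_conj_map_eval_eq_zero {ι : Type*} [Fintype ι] [DecidableEq ι] {k N : ℕ}
    {u : (Matrix ι ι ℂ[X])ˣ} {M : Matrix ι ι ℂ[X]}
    (hu : (u : Matrix ι ι ℂ[X]) = 1 + (X ^ (k + 1) : ℂ[X]) • M)
    (c : Fin N → (Matrix ι ι ℂ[X])ˣ)
    (h : (List.ofFn fun i => c i * u * (c i)⁻¹).prod = 1) :
    ∑ i, (evalRingHom (0 : ℂ)).mapMatrix ((c i).val * M * (c i)⁻¹.val) = 0 := by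
  obtain ⟨Z, hZ⟩ := exists_prod_one_add_X_pow_smul k
    (List.ofFn fun i => (c i).val * M * (c i)⁻¹.val)
  have h1 : ((List.ofFn fun i => (c i).val * M * (c i)⁻¹.val).map
      fun M => 1 + (X ^ (k + 1) : ℂ[X]) • M).prod = 1 := by
    have h2 := congrArg (Units.coeHom (Matrix ι ι ℂ[X])) h
    rw [map_list_prod, map_one, List.map_ofFn] at h2
    refine Eq.trans ?_ h2
    rw [List.map_ofFn]
    congr 2
    funext i
    simp only [Function.comp_apply, Units.coeHom_apply, Units.val_mul, hu]
    rw [mul_add, add_mul, mul_one, Units.mul_inv, mul_smul_comm, smul_mul_assoc]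
  rw [h1, left_eq_add] at hZ
  have h3 : (List.ofFn fun i => (c i).val * M * (c i)⁻¹.val).sum + (X : ℂ[X]) • Z = 0 := by
    ext1 i j
    have := congrFun (congrFun hZ i) j
    rw [Matrix.smul_apply, smul_eq_mul, Matrix.zero_apply] at this
    exact (mul_eq_zero.1 this).resolve_left (pow_ne_zero _ X_ne_zero)
  rw [List.sum_ofFn] at h3
  have h4 := congrArg (evalRingHom (0 : ℂ)).mapMatrix h3
  rw [map_add, map_sum, map_zero] at h4
  have h5 : (evalRingHom (0 : ℂ)).mapMatrix ((X : ℂ[X]) • Z) = 0 := by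
    ext i j
    simp
  rwa [h5, add_zero] at h4

end Expansion

/-! ### The spectrum of an element of the torus knot group -/

section Spectrum

open Polynomial Matrix

/-- The one-parameter subgroup `a ↦ diag(1, a)` of complex matrices. -/
noncomputable def complexDiagHom : ℂ →* Matrix (Fin 2) (Fin 2) ℂ where
  toFun a := Matrix.diagonal ![1, a]
  map_one' := by ext i j; fin_cases i <;> fin_cases j <;> simp
  map_mul' a b := by ext i j; fin_cases i <;> fin_cases j <;> simp

theorem mapMatrix_eval_diagHom (a : ℂ) :
    (evalRingHom (0 : ℂ)).mapMatrix (diagHom a) = complexDiagHom a := by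
  ext i j; fin_cases i <;> fin_cases j <;> simp [diagHom, complexDiagHom]

theorem mapMatrix_eval_shearHom (a : ℂ) :
    (evalRingHom (0 : ℂ)).mapMatrix (shearHom a) = complexDiagHom a := by
  ext i j; fin_cases i <;> fin_cases j <;> simp [shearHom, complexDiagHom]

open GenTorsion in
/-- A group with the presentation `⟨x, y | x ^ m = y ^ n⟩`, where `m * n = p ^ a * q ^ b`. -/
theorem eqnSpectrum_subset {G : Type*} [Group G] {p q a b m n : ℕ} (hp : p.Prime) (hq : q.Prime)
    (hpq : p ≠ q) (hmn : m * n = p ^ a * q ^ b) {x y : G}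
    (hgen : Subgroup.closure {x, y} = ⊤) (hrel : x ^ m = y ^ n)
    (hlift : ∀ (Γ : Type) [Group Γ] (A B : Γ), A ^ m = B ^ n → ∃ Φ : G →* Γ, Φ x = A ∧ Φ y = B)
    {g : G} (hg : g ≠ 1) : eqnSpectrum g ⊆ {N : ℕ | p ∣ N} ∪ {N : ℕ | q ≤ N} := by
  rintro N ⟨hN, c, hc⟩
  rw [Set.mem_union, Set.mem_ofPred_eq, Set.mem_ofPred_eq]
  refine or_iff_not_imp_right.2 fun hNq => ?_
  rw [not_le] at hNq
  have hpos : 0 < m * n := hmn ▸ Nat.mul_pos (pow_pos hp.pos _) (pow_pos hq.pos _)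
  have hm : 0 < m := Nat.pos_of_mul_pos_right hpos
  have hn : 0 < n := Nat.pos_of_mul_pos_left hpos
  have hprim := Complex.isPrimitiveRoot_exp (m * n) hpos.ne'
  obtain ⟨η, hη⟩ : ∃ η : ℂˣ, IsPrimitiveRoot η (m * n) := by
    refine ⟨Units.mk0 _ (hprim.ne_zero hpos.ne'), ?_⟩
    rw [← IsPrimitiveRoot.coe_units_iff]
    exact hprim
  have hζ := hη.pow hpos (mul_comm m n)
  have hω := hη.pow hpos rfl
  obtain ⟨φ, hφx, hφy⟩ := hlift (Multiplicative ℤ) (Multiplicative.ofAdd (n : ℤ))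
    (Multiplicative.ofAdd (m : ℤ)) (by
      rw [← ofAdd_nsmul, ← ofAdd_nsmul]; simp [mul_comm])
  obtain ⟨ρ, hρx, hρy⟩ := hlift (Matrix (Fin 2) (Fin 2) ℂ[X])ˣ (Units.map diagHom (η ^ n))
    (Units.map shearHom (η ^ m)) (by
      rw [← map_pow, ← map_pow, hζ.pow_eq_one, hω.pow_eq_one, map_one, map_one])
  -- At `X = 0` the idempotent becomes `diag(0, 1)`, so both generators become diagonal, with second
  -- entries `η ^ n` and `η ^ m`.
  have hspec : ∀ h : G, (evalRingHom (0 : ℂ)).mapMatrix (ρ h : Matrix (Fin 2) (Fin 2) ℂ[X]) =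
      complexDiagHom ((η ^ (Multiplicative.toAdd (φ h)) : ℂˣ) : ℂ) := by
    have : (Units.map ((evalRingHom (0 : ℂ)).mapMatrix (m := Fin 2)).toMonoidHom).comp ρ =
        ((Units.map complexDiagHom).comp (zpowersHom ℂˣ η)).comp φ := by
      refine MonoidHom.eq_of_eqOn_dense hgen ?_
      rintro z (rfl | rfl)
      · refine Units.ext ?_
        simp [hρx, hφx, mapMatrix_eval_diagHom, -RingHom.mapMatrix_apply]
      · refine Units.ext ?_
        simp [hρy, hφy, mapMatrix_eval_shearHom, -RingHom.mapMatrix_apply]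
    intro h
    exact congrArg Units.val (DFunLike.congr_fun this h)
  -- In the commutative group `ℤ` the product of conjugates is the `N`-th power of `φ g`, and there
  -- is no torsion.
  have hφg : φ g = 1 := by
    have h1 := congrArg φ hc
    rw [map_list_prod, map_one, List.map_ofFn] at h1
    have h2 : (φ ∘ fun i => c i * g * (c i)⁻¹) = fun _ => φ g := by
      funext i
      simp [mul_comm]
    rw [h2, List.ofFn_const, List.prod_replicate] at h1
    exact (pow_eq_one_iff_left hN.ne').1 h1
  have hρg : ρ g ≠ 1 := by
    intro h
    obtain ⟨i, rfl⟩ := exists_eq_zpow_of_rho_eq_one hgen hrel hρx hρy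
      (fun i hi => (hζ.zpow_eq_one_iff_dvd i).1 hi) (fun i hi => (hω.zpow_eq_one_iff_dvd i).1 hi) h
    rw [map_zpow, hφx, ← ofAdd_zsmul, ofAdd_eq_one, smul_eq_mul, mul_eq_zero] at hφg
    rcases hφg with h0 | h0
    · exact hg (by rw [h0, zpow_zero])
    · omega
  obtain ⟨k, M, hM, r, s, hrs⟩ := exists_eq_X_pow_smul
    ((ρ g : Matrix (Fin 2) (Fin 2) ℂ[X]) - 1)
    (fun h => hρg (Units.ext (sub_eq_zero.1 h))) (by
      intro i j
      have h1 := hspec g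
      rw [hφg, toAdd_one, zpow_zero, Units.val_one, map_one] at h1
      have h2 := congrFun (congrFun h1 i) j
      rw [Matrix.sub_apply, coeff_sub, coeff_zero_eq_eval_zero, coeff_zero_eq_eval_zero]
      have h3 : ((1 : Matrix (Fin 2) (Fin 2) ℂ[X]) i j).eval 0 =
          (1 : Matrix (Fin 2) (Fin 2) ℂ) i j := by
        rw [Matrix.one_apply, Matrix.one_apply]; split_ifs <;> simp
      rw [h3, sub_eq_zero]
      exact h2)
  have hsum := sum_conj_map_eval_eq_zero (sub_eq_iff_eq_add'.1 hM) (fun i => ρ (c i)) (by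
    rw [← map_one ρ, ← hc, map_list_prod, List.map_ofFn]
    congr 2
    funext i
    simp)
  have hentry : ∀ i, ((evalRingHom (0 : ℂ)).mapMatrix
      ((ρ (c i)).val * M * (ρ (c i))⁻¹.val)) r s =
      ![1, ((η ^ (Multiplicative.toAdd (φ (c i))) : ℂˣ) : ℂ)] r * (M r s).eval 0 *
        ![1, ((η ^ (-Multiplicative.toAdd (φ (c i))) : ℂˣ) : ℂ)] s := by
    intro i
    rw [map_mul, map_mul, ← map_inv, hspec, hspec, map_inv, toAdd_inv]
    exact (Matrix.mul_diagonal _ _ _ _).trans (congrArg (· * _) (Matrix.diagonal_mul _ _ _ _))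
  have hex : ∃ e : Fin N → ℤ, ∑ i, (η : ℂ) ^ e i = 0 := by
    have h1 := congrFun (congrFun hsum r) s
    rw [Matrix.sum_apply, Matrix.zero_apply] at h1
    simp only [hentry] at h1
    -- Conjugation by `diag(1, d)` multiplies the four entries by `1`, `d⁻¹`, `d` and `1`, always a
    -- power of `η`.
    have h2 : ∃ e : Fin N → ℤ, ∀ i,
        ![1, ((η ^ (Multiplicative.toAdd (φ (c i))) : ℂˣ) : ℂ)] r * (M r s).eval 0 *
        ![1, ((η ^ (-Multiplicative.toAdd (φ (c i))) : ℂˣ) : ℂ)] s =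
        (η : ℂ) ^ e i * (M r s).eval 0 := by
      fin_cases r <;> fin_cases s
      · exact ⟨fun _ => 0, fun i => by simp⟩
      · exact ⟨fun i => -Multiplicative.toAdd (φ (c i)), fun i => by simp [mul_comm]⟩
      · exact ⟨fun i => Multiplicative.toAdd (φ (c i)), fun i => by simp⟩
      · exact ⟨fun _ => 0, fun i => by
          have h0 : (η : ℂ) ^ Multiplicative.toAdd (φ (c i)) ≠ 0 :=
            zpow_ne_zero _ (Units.ne_zero η)
          simp
          field_simp⟩
    obtain ⟨e, he⟩ := h2
    refine ⟨e, ?_⟩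
    rw [Finset.sum_congr rfl fun i _ => he i, ← Finset.sum_mul] at h1
    exact (mul_eq_zero.1 h1).resolve_right hrs
  obtain ⟨e, he⟩ := hex
  have hη' : IsPrimitiveRoot (η : ℂ) (p ^ a * q ^ b) := by
    rw [← hmn]; exact IsPrimitiveRoot.coe_units_iff.2 hη
  have := dvd_card_of_sum_roots_of_unity_eq_zero hp hq hpq hη' (by rwa [Fintype.card_fin]) e he
  rwa [Fintype.card_fin] at this

end Spectrum

end TorusGroup

/-! ### Monodromy of locally constant cocycles -/

namespace CechMonodromy

open Topology unitInterval Bundle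

variable {X Γ ι : Type*} [Group Γ] {W : ι → Set X} {g : ι → X → Γ}

/-- A path in `Γ` which is locally constant in the local trivialisations given by `g`, along `γ`. -/
def IsFlat (W : ι → Set X) (g : ι → X → Γ) (γ : I → X) (u : I → Γ) : Prop :=
  ∀ t, ∃ i, γ t ∈ W i ∧ ∀ᶠ s in 𝓝 t, g i (γ s) * u s = g i (γ t) * u t

theorem IsFlat.mul_right {γ : I → X} {u : I → Γ} (hu : IsFlat W g γ u) (c : Γ) :
    IsFlat W g γ fun t => u t * c := by
  intro t
  obtain ⟨i, hi, h⟩ := hu t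
  refine ⟨i, hi, h.mono fun s hs => ?_⟩
  rw [← mul_assoc, hs, mul_assoc]

variable [TopologicalSpace X] [TopologicalSpace Γ] [DiscreteTopology Γ]

/-- The principal `Γ`-bundle with transition functions `g j * (g i)⁻¹`. -/
def core (hW : ∀ i, IsOpen (W i)) (idx : X → ι) (hidx : ∀ x, x ∈ W (idx x))
    (hloc : ∀ i j, ∀ x ∈ W i ∩ W j, ∀ᶠ y in 𝓝 x, g j y * (g i y)⁻¹ = g j x * (g i x)⁻¹) :
    FiberBundleCore ι X Γ where
  baseSet := W
  isOpen_baseSet := hW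
  indexAt := idx
  mem_baseSet_at := hidx
  coordChange i j x v := g j x * (g i x)⁻¹ * v
  coordChange_self i x _ v := by simp
  continuousOn_coordChange i j := by
    rintro ⟨x, v⟩ ⟨hx, -⟩
    apply ContinuousAt.continuousWithinAt
    have h : (fun p : X × Γ => g j p.1 * (g i p.1)⁻¹ * p.2) =ᶠ[𝓝 (x, v)]
        fun _ => g j x * (g i x)⁻¹ * v := by
      have h2 : ∀ᶠ w in 𝓝 v, w = v := by rw [nhds_discrete]; rfl
      filter_upwards [(hloc i j x hx).prodMk_nhds h2] with p hp
      rw [hp.1, hp.2]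
    exact continuousAt_const.congr h.symm
  coordChange_comp i j k x _ v := by group

variable (hW : ∀ i, IsOpen (W i)) (idx : X → ι) (hidx : ∀ x, x ∈ W (idx x))
    (hloc : ∀ i j, ∀ x ∈ W i ∩ W j, ∀ᶠ y in 𝓝 x, g j y * (g i y)⁻¹ = g j x * (g i x)⁻¹)

theorem isCoveringMap_core :
    IsCoveringMap (π Γ (core hW idx hidx hloc).Fiber) :=
  FiberBundle.isCoveringMap

/-- The point over `x` with frame-independent coordinate `u`. -/
def pt (x : X) (u : Γ) : (core hW idx hidx hloc).TotalSpace :=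
  ⟨x, g (idx x) x * u⟩

theorem localTriv_pt (i : ι) (x : X) (u : Γ) :
    (core hW idx hidx hloc).localTriv i (pt hW idx hidx hloc x u) = (x, g i x * u) := by
  rw [FiberBundleCore.localTriv_apply]
  refine Prod.ext rfl ?_
  change g i x * (g (idx x) x)⁻¹ * (g (idx x) x * u) = g i x * u
  group

theorem eventually_mem_source {γ : I → X} (hγ : Continuous γ) {i : ι} {t : I} (hi : γ t ∈ W i)
    (u : I → Γ) :
    (fun s => pt hW idx hidx hloc (γ s) (u s)) ⁻¹'
      ((core hW idx hidx hloc).localTriv i).toOpenPartialHomeomorph.source ∈ 𝓝 t := by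
  have h : γ ⁻¹' W i ∈ 𝓝 t := hγ.continuousAt.preimage_mem_nhds ((hW i).mem_nhds hi)
  filter_upwards [h] with s hs
  exact ((core hW idx hidx hloc).mem_localTriv_source i _).2 hs

/-- In the chart `i` the second coordinate is `g i (γ s) * u s`, and continuity into a discrete
space is local constancy. The functions `g i` and `u` themselves may be discontinuous. -/
theorem continuous_pt_iff_isFlat {γ : I → X} (hγ : Continuous γ) (u : I → Γ) :
    Continuous (fun s => pt hW idx hidx hloc (γ s) (u s)) ↔ IsFlat W g γ u := by
  have key : ∀ (t : I) (i : ι), γ t ∈ W i →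
      (ContinuousAt (fun s => pt hW idx hidx hloc (γ s) (u s)) t ↔
        ∀ᶠ s in 𝓝 t, g i (γ s) * u s = g i (γ t) * u t) := by
    intro t i hi
    rw [((core hW idx hidx hloc).localTriv
      i).toOpenPartialHomeomorph.continuousAt_iff_continuousAt_comp_left
        (eventually_mem_source hW idx hidx hloc hγ hi u)]
    have e : (((core hW idx hidx hloc).localTriv i).toOpenPartialHomeomorph ∘
        fun s => pt hW idx hidx hloc (γ s) (u s)) = fun s => (γ s, g i (γ s) * u s) :=
      funext fun s => localTriv_pt hW idx hidx hloc i _ _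
    have e2 : ContinuousAt (fun s => (γ s, g i (γ s) * u s)) t ↔
        ContinuousAt (fun s => g i (γ s) * u s) t :=
      ⟨fun h => h.snd, fun h => hγ.continuousAt.prodMk h⟩
    rw [e, e2, ContinuousAt, nhds_discrete Γ, Filter.tendsto_pure]
  rw [continuous_iff_continuousAt]
  constructor
  · intro h t
    exact ⟨idx (γ t), hidx _, (key t _ (hidx _)).1 (h t)⟩
  · intro h t
    obtain ⟨i, hi, hs⟩ := h t
    exact (key t i hi).2 hs

/-- `pt` as an element of the fibre. -/
def fibrePt (x : X) (u : Γ) : π Γ (core hW idx hidx hloc).Fiber ⁻¹' {x} :=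
  ⟨pt hW idx hidx hloc x u, rfl⟩

theorem fibrePt_injective (x : X) : Function.Injective (fibrePt hW idx hidx hloc x) := by
  intro u v h
  have h1 := congrArg (fun e => (core hW idx hidx hloc).localTriv (idx x) e.1) h
  simp only [fibrePt, localTriv_pt] at h1
  exact mul_left_cancel (Prod.ext_iff.1 h1).2

/-- A flat `u` is a continuous lift of `γ`, and lifts to a covering are unique. -/
theorem monodromy_of_isFlat {x y : X} (γ : Path x y) {u : I → Γ} (hu : IsFlat W g γ u) :
    (isCoveringMap_core hW idx hidx hloc).monodromy (.mk γ) (fibrePt hW idx hidx hloc x (u 0)) =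
      fibrePt hW idx hidx hloc y (u 1) := by
  have hc := (continuous_pt_iff_isFlat hW idx hidx hloc γ.continuous u).2 hu
  have h0 : pt hW idx hidx hloc (γ 0) (u 0) = pt hW idx hidx hloc x (u 0) := by rw [γ.source]
  have h1 : pt hW idx hidx hloc (γ 1) (u 1) = pt hW idx hidx hloc y (u 1) := by rw [γ.target]
  apply Subtype.ext
  have := ((isCoveringMap_core hW idx hidx hloc).eq_liftPath_iff
    (γ := ⟨γ, γ.continuous⟩) (e := pt hW idx hidx hloc x (u 0)) (γ_0 := γ.source)).2
    ⟨hc, rfl, h0⟩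
  exact (congrFun this 1).symm.trans h1

/-- The frame-independent coordinate of a point of the total space. -/
def coord (e : (core hW idx hidx hloc).TotalSpace) : Γ :=
  let w : Γ := e.2
  (g (idx e.1) e.1)⁻¹ * w

theorem exists_isFlat (hW : ∀ i, IsOpen (W i)) (idx : X → ι) (hidx : ∀ x, x ∈ W (idx x))
    (hloc : ∀ i j, ∀ x ∈ W i ∩ W j, ∀ᶠ y in 𝓝 x, g j y * (g i y)⁻¹ = g j x * (g i x)⁻¹) {x y : X}
    (γ : Path x y) (v : Γ) : ∃ u, IsFlat W g γ u ∧ u 0 = v := by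
  obtain ⟨F, hF, hF0⟩ := (isCoveringMap_core hW idx hidx hloc).exists_path_lifts
    ⟨γ, γ.continuous⟩ (pt hW idx hidx hloc x v) γ.source
  have hpt : ∀ e : (core hW idx hidx hloc).TotalSpace,
      pt hW idx hidx hloc e.1 (coord hW idx hidx hloc e) = e := by
    rintro ⟨z, w⟩
    exact congrArg (Bundle.TotalSpace.mk z) (mul_inv_cancel_left (g (idx z) z) (id w : Γ))
  have hp : ∀ t, (F t).1 = γ t := fun t => congrFun hF t
  have hF' : (fun t => pt hW idx hidx hloc (γ t) (coord hW idx hidx hloc (F t))) = F := by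
    funext t
    rw [← hp]
    exact hpt _
  refine ⟨_, (continuous_pt_iff_isFlat hW idx hidx hloc γ.continuous _).1
    (hF' ▸ F.continuous), ?_⟩
  rw [hF0]
  exact inv_mul_cancel_left _ _

end CechMonodromy

open Topology unitInterval CechMonodromy in
/-- The monodromy homomorphism of a Čech cocycle `g j * (g i)⁻¹` which is locally constant. -/
theorem exists_hom_of_cech {X Γ ι : Type*} [TopologicalSpace X] [Group Γ] {W : ι → Set X}
    {g : ι → X → Γ} (hW : ∀ i, IsOpen (W i)) (hcov : ∀ x, ∃ i, x ∈ W i)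
    (hloc : ∀ i j, ∀ x ∈ W i ∩ W j, ∀ᶠ y in 𝓝 x, g j y * (g i y)⁻¹ = g j x * (g i x)⁻¹) (x : X) :
    ∃ Φ : FundamentalGroup X x →* Γ, ∀ (γ : Path x x) (u : I → Γ), IsFlat W g γ u →
      Φ (.mk γ) = u 1 * (u 0)⁻¹ := by
  let _ : TopologicalSpace Γ := ⊥
  have _ : DiscreteTopology Γ := ⟨rfl⟩
  choose idx hidx using hcov
  have hex : ∀ p : Path.Homotopic.Quotient x x, ∃ a : Γ, ∀ v : Γ,
      (isCoveringMap_core hW idx hidx hloc).monodromy p (fibrePt hW idx hidx hloc x v) =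
        fibrePt hW idx hidx hloc x (a * v) := by
    intro p
    induction p using Quotient.inductionOn with
    | h γ =>
    -- Right translates of the flat `u` starting at `1` are flat, so monodromy is left
    -- multiplication by `u 1` on the whole fibre.
    obtain ⟨u, hu, hu0⟩ := exists_isFlat hW idx hidx hloc γ 1
    refine ⟨u 1, fun v => ?_⟩
    have := monodromy_of_isFlat hW idx hidx hloc γ (hu.mul_right v)
    rwa [hu0, one_mul] at this
  choose Φ hΦ using hex
  refine ⟨MonoidHom.mk' Φ fun p q => ?_, fun γ u hu => ?_⟩
  -- The product `p * q` in the fundamental group runs along `q` first and then along `p`.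
  · have h1 := hΦ (Path.Homotopic.Quotient.trans q p) 1
    rw [IsCoveringMap.monodromy_trans_apply, hΦ, hΦ] at h1
    have := fibrePt_injective hW idx hidx hloc x h1
    rw [mul_one, mul_one] at this
    exact this.symm
  · have h1 := hΦ (.mk γ) (u 0)
    rw [monodromy_of_isFlat hW idx hidx hloc γ hu] at h1
    rw [fibrePt_injective hW idx hidx hloc x h1, mul_inv_cancel_right]
    rfl

/-! ### Generators of fundamental groups -/

open unitInterval in
/-- The generation half of the Seifert–van Kampen theorem: if `x₀` can be joined to every point `p`
inside all the members of an open cover which contain `p`, then `π₁(X, x₀)` is generated by the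
loops that lie in a member of the cover. -/
theorem FundamentalGroup.eq_top_of_open_cover {X ι : Type*} [TopologicalSpace X] {U : ι → Set X}
    (hU : ∀ i, IsOpen (U i)) (hcov : ∀ x, ∃ i, x ∈ U i) {x₀ : X}
    (hjoin : ∀ p, ∃ η : Path x₀ p, ∀ i, p ∈ U i → ∀ t, η t ∈ U i)
    (H : Subgroup (FundamentalGroup X x₀))
    (hH : ∀ i (γ : Path x₀ x₀), (∀ t, γ t ∈ U i) →
        (Path.Homotopic.Quotient.mk γ : FundamentalGroup X x₀) ∈ H) :
    H = ⊤ := by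
  choose η hη using hjoin
  have hloop : ∀ {p q : X} (τ : Path p q), (∃ i, ∀ t, τ t ∈ U i) →
      (Path.Homotopic.Quotient.mk (((η p).trans τ).trans (η q).symm) :
          FundamentalGroup X x₀) ∈ H := by
    rintro p q τ ⟨i, hi⟩
    have hp : p ∈ U i := by simpa using hi 0
    have hq : q ∈ U i := by simpa using hi 1
    apply hH i
    rw [← Set.range_subset_iff, Path.trans_range, Path.trans_range, Path.symm_range]
    exact Set.union_subset (Set.union_subset (Set.range_subset_iff.2 (hη p i hp))
      (Set.range_subset_iff.2 hi)) (Set.range_subset_iff.2 (hη q i hq))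
  have hcast : ∀ {p q p' q' : X} (τ : Path p q) (hp : p' = p) (hq : q' = q),
      (Path.Homotopic.Quotient.mk (((η p').trans (τ.cast hp hq)).trans (η q').symm) :
          FundamentalGroup X x₀) =
        Path.Homotopic.Quotient.mk (((η p).trans τ).trans (η q).symm) := by
    rintro p q p' q' τ rfl rfl
    rfl
  have hall : ∀ γ : Path x₀ x₀,
      (Path.Homotopic.Quotient.mk (((η x₀).trans γ).trans (η x₀).symm) :
          FundamentalGroup X x₀) ∈ H := by
    intro γ
    -- A Lebesgue subdivision: each piece of `γ`, closed up by the paths `η` to its endpoints, is a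
    -- loop in one member of the cover.
    obtain ⟨t, ht0, htm, ⟨N, hN⟩, ht⟩ := exists_monotone_Icc_subset_open_cover_unitInterval
      (c := fun i => γ ⁻¹' U i) (fun i => (hU i).preimage γ.continuous) (fun s _ => by
        obtain ⟨i, hi⟩ := hcov (γ s)
        exact Set.mem_iUnion.2 ⟨i, hi⟩)
    have hsub : ∀ k,
        (Path.Homotopic.Quotient.mk (((η (γ 0)).trans (γ.subpath 0 (t k))).trans (η (γ (t k))).symm) :
        FundamentalGroup X x₀) ∈ H := by
      intro k
      induction k with
      | zero =>
        apply hloop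
        obtain ⟨i, hi⟩ := hcov (γ 0)
        refine ⟨i, fun s => ?_⟩
        rw [ht0, Path.subpath_self]
        exact hi
      | succ k ih =>
        have hstep := hloop (γ.subpath (t k) (t (k + 1))) (by
          obtain ⟨i, hi⟩ := ht k
          refine ⟨i, ?_⟩
          rw [← Set.range_subset_iff, Path.range_subpath_of_le _ _ _ (htm (Nat.le_succ k))]
          exact Set.image_subset_iff.2 hi)
        have h1 : Path.Homotopic.Quotient.mk (γ.subpath 0 (t (k + 1))) =
            (Path.Homotopic.Quotient.mk (γ.subpath 0 (t k))).trans
              (Path.Homotopic.Quotient.mk (γ.subpath (t k) (t (k + 1)))) :=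
          Path.Homotopic.Quotient.eq.2
            ⟨(Path.Homotopy.subpathTransSubpath γ 0 (t k) (t (k + 1))).symm⟩
        have h2 : (Path.Homotopic.Quotient.mk (((η (γ 0)).trans
            (γ.subpath 0 (t (k + 1)))).trans (η (γ (t (k + 1)))).symm)) =
            (Path.Homotopic.Quotient.mk (((η (γ 0)).trans (γ.subpath 0 (t k))).trans
              (η (γ (t k))).symm)).trans (Path.Homotopic.Quotient.mk (((η (γ (t k))).trans
              (γ.subpath (t k) (t (k + 1)))).trans (η (γ (t (k + 1)))).symm)) := by
          simp only [Path.Homotopic.Quotient.mk_trans, Path.Homotopic.Quotient.mk_symm, h1]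
          simp only [Path.Homotopic.Quotient.trans_assoc]
          rw [← Path.Homotopic.Quotient.trans_assoc
            (Path.Homotopic.Quotient.mk (η (γ (t k)))).symm,
            Path.Homotopic.Quotient.symm_trans, Path.Homotopic.Quotient.refl_trans]
        exact Set.mem_of_eq_of_mem h2 (H.mul_mem hstep ih)
    have h1 := hsub N
    have h2 :
        (Path.Homotopic.Quotient.mk (((η (γ 0)).trans (γ.subpath 0 (t N))).trans (η (γ (t N))).symm) :
        FundamentalGroup X x₀) =
            Path.Homotopic.Quotient.mk (((η x₀).trans γ).trans (η x₀).symm) := by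
      rw [hN N le_rfl, Path.subpath_zero_one, hcast]
    rwa [h2] at h1
  rw [Subgroup.eq_top_iff']
  intro g
  induction g using Path.Homotopic.Quotient.ind with
  | mk γ =>
  obtain ⟨i, hi⟩ := hcov x₀
  -- The path `η x₀` need not be constant, but it is itself a loop in a member of the cover, so
  -- conjugation by it stays in `H`.
  have hη0 : (Path.Homotopic.Quotient.mk (η x₀) : FundamentalGroup X x₀) ∈ H := hH i _ (hη x₀ i hi)
  have h3 : Path.Homotopic.Quotient.mk γ = (Path.Homotopic.Quotient.mk (η x₀)).symm.trans
      ((Path.Homotopic.Quotient.mk (((η x₀).trans γ).trans (η x₀).symm)).trans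
        (Path.Homotopic.Quotient.mk (η x₀))) := by
    simp only [Path.Homotopic.Quotient.mk_trans, Path.Homotopic.Quotient.mk_symm]
    simp only [Path.Homotopic.Quotient.trans_assoc, Path.Homotopic.Quotient.symm_trans,
      Path.Homotopic.Quotient.trans_refl]
    rw [← Path.Homotopic.Quotient.trans_assoc, Path.Homotopic.Quotient.symm_trans,
      Path.Homotopic.Quotient.refl_trans]
  exact Set.mem_of_eq_of_mem h3 (H.mul_mem (H.mul_mem hη0 (hall γ)) (H.inv_mem hη0))

open unitInterval in
/-- Loops which lift to a simply connected space with an action of `ℤ` by deck transformations are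
powers of a single loop. -/
theorem FundamentalGroup.exists_deck_generator {E X : Type*} [TopologicalSpace E]
    [TopologicalSpace X] [SimplyConnectedSpace E] (P : C(E, X)) (F : ℤ → C(E, E))
    (hF : ∀ j k e, F (j + k) e = F j (F k e)) (hP : ∀ k e, P (F k e) = P e) (e₀ : E) {x₀ : X}
    (hx₀ : P e₀ = x₀) :
    ∃ x : FundamentalGroup X x₀, ∀ (k : ℤ) (γ : Path x₀ x₀) (δ : C(I, E)), δ 0 = e₀ →
      δ 1 = F k e₀ → (∀ t, P (δ t) = γ t) → Path.Homotopic.Quotient.mk γ = x ^ k := by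
  subst hx₀
  let D : ℤ → FundamentalGroup X (P e₀) := fun k =>
    Path.Homotopic.Quotient.mk (((PathConnectedSpace.somePath e₀ (F k e₀)).map P.continuous).cast rfl
        (hP k e₀).symm)
  -- In a simply connected space the endpoints determine a path up to homotopy, so the class of `γ`
  -- depends on `k` alone.
  have hD : ∀ (k : ℤ) (γ : Path (P e₀) (P e₀)) (δ : C(I, E)), δ 0 = e₀ →
      δ 1 = F k e₀ → (∀ t, P (δ t) = γ t) → Path.Homotopic.Quotient.mk γ = D k := by
    intro k γ δ h0 h1 hγ
    let δ' : Path e₀ (F k e₀) := ⟨δ, h0, h1⟩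
    have hγ' : γ = (δ'.map P.continuous).cast rfl (hP k e₀).symm := Path.ext (funext fun t =>
      (hγ t).symm)
    rw [hγ']
    exact Path.Homotopic.Quotient.eq.2
        (((SimplyConnectedSpace.paths_homotopic δ' _).map P).pathCast _ _)
  have hadd : ∀ j k, D (j + k) = D j * D k := by
    intro j k
    -- The product loop lifts to a path from `e₀` to `F k e₀`, followed by the `F k`-translate of a
    -- path from `e₀` to `F j e₀`.
    have h := hD (j + k) ((((PathConnectedSpace.somePath e₀ (F k e₀)).map P.continuous).cast rfl
      (hP k e₀).symm).trans (((PathConnectedSpace.somePath e₀ (F j e₀)).map P.continuous).cast rfl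
      (hP j e₀).symm)) (((PathConnectedSpace.somePath e₀ (F k e₀)).trans
        ((PathConnectedSpace.somePath e₀ (F j e₀)).map (F k).continuous)).cast rfl
          (by rw [add_comm, hF] : F (j + k) e₀ = F k (F j e₀)) :
              Path e₀ (F (j + k) e₀)).toContinuousMap
      (Path.source _) (Path.target _) (by
        intro t
        simp only [Path.coe_toContinuousMap, Path.cast_coe, Path.trans_apply]
        split_ifs
        · rfl
        · exact hP k _)
    rw [← h]
    rfl
  have h0 : D 0 = 1 := by
    have := hadd 0 0
    rwa [add_zero, left_eq_mul] at this
  let Φ : Multiplicative ℤ →* FundamentalGroup X (P e₀) :=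
    { toFun := fun k => D k.toAdd, map_one' := h0, map_mul' := fun j k => hadd _ _ }
  refine ⟨D 1, fun k γ δ h0 h1 hγ => ?_⟩
  rw [hD k γ δ h0 h1 hγ]
  have := map_zpow Φ (Multiplicative.ofAdd 1) k
  rw [← ofAdd_zsmul, smul_eq_mul, mul_one] at this
  exact this

/-! ### The model in `ℂ²` and the coverings of its two sides -/

namespace TorusModel

open Complex Topology ComplexConjugate

/-- The form `-z₁ ^ n * conj z₂ ^ m`, which takes its value in the slit plane when
`z₁ ^ n * conj z₂ ^ m` is not a nonnegative real number. -/
noncomputable def slitForm (m n : ℕ) (z : ℂ × ℂ) : ℂ := -(z.1 ^ n * conj z.2 ^ m)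

/-- A four-dimensional model of the complement of the `(m, n)`-torus knot. -/
def Model (m n : ℕ) : Set (ℂ × ℂ) :=
  {z | ‖z.1‖ < ‖z.2‖ ∨ ‖z.2‖ < ‖z.1‖ ∨ slitForm m n z ∈ slitPlane}

/-- The region of `ℂ × ℂ` which retracts onto the circle `z₁ = 0`. -/
def Region (m n : ℕ) : Set (ℂ × ℂ) := {z | ‖z.1‖ < ‖z.2‖ ∨ slitForm m n z ∈ slitPlane}

variable {m n : ℕ}

theorem continuous_slitForm : Continuous (slitForm m n) := by
  unfold slitForm
  exact ((continuous_fst.pow n).mul ((continuous_conj.comp continuous_snd).pow m)).neg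

theorem isOpen_Region : IsOpen (Region m n) :=
  (isOpen_lt (f := fun z : ℂ × ℂ => ‖z.1‖) (g := fun z => ‖z.2‖) (by fun_prop)
    (by fun_prop)).union (isOpen_slitPlane.preimage continuous_slitForm)

theorem Region_subset_Model : Region m n ⊆ Model m n := by
  rintro z (h | h)
  exacts [Or.inl h, Or.inr (Or.inr h)]

theorem snd_ne_zero_of_slitForm (hm : 0 < m) {z : ℂ × ℂ} (hz : slitForm m n z ∈ slitPlane) :
    z.2 ≠ 0 := by
  intro h
  apply slitPlane_ne_zero hz
  rw [slitForm, h, map_zero, zero_pow hm.ne', mul_zero, neg_zero]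

theorem fst_ne_zero_of_slitForm (hn : 0 < n) {z : ℂ × ℂ} (hz : slitForm m n z ∈ slitPlane) :
    z.1 ≠ 0 := by
  intro h
  apply slitPlane_ne_zero hz
  rw [slitForm, h, zero_pow hn.ne', zero_mul, neg_zero]

theorem snd_ne_zero_of_mem_Region (hm : 0 < m) {z : ℂ × ℂ} (hz : z ∈ Region m n) : z.2 ≠ 0 := by
  rcases hz with h | h
  · intro h0
    rw [h0, norm_zero] at h
    exact absurd h (norm_nonneg _).not_gt
  · exact snd_ne_zero_of_slitForm hm h

theorem ofReal_mul_mem_slitPlane {r : ℝ} (hr : 0 < r) {z : ℂ} :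
    (r : ℂ) * z ∈ slitPlane ↔ z ∈ slitPlane := by
  rw [mem_slitPlane_iff, mem_slitPlane_iff, re_ofReal_mul, im_ofReal_mul]
  simp [hr, hr.ne']

theorem slitForm_swap (z : ℂ × ℂ) : slitForm n m z.swap = conj (slitForm m n z) := by
  simp [slitForm, mul_comm]

theorem slitForm_swap_mem (z : ℂ × ℂ) :
    slitForm n m z.swap ∈ slitPlane ↔ slitForm m n z ∈ slitPlane := by
  rw [slitForm_swap, mem_slitPlane_iff, mem_slitPlane_iff, conj_re, conj_im, neg_ne_zero]

theorem swap_mem_Model (z : ℂ × ℂ) : z.swap ∈ Model n m ↔ z ∈ Model m n := by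
  simp only [Model, Set.mem_ofPred_eq, slitForm_swap_mem, Prod.fst_swap, Prod.snd_swap]
  tauto

/-- Exchanging the two coordinates. -/
def swapModel (m n : ℕ) : Model n m ≃ₜ Model m n where
  toFun z := ⟨z.1.swap, (swap_mem_Model _).2 z.2⟩
  invFun z := ⟨z.1.swap, (swap_mem_Model _).2 z.2⟩
  left_inv z := Subtype.ext (Prod.swap_swap _)
  right_inv z := Subtype.ext (Prod.swap_swap _)
  continuous_toFun := by fun_prop
  continuous_invFun := by fun_prop

/-- The factor by which the first coordinate is rotated and scaled. -/
noncomputable def twist (m n : ℕ) (l : ℂ) : ℂ := exp (l.re + (m / n * l.im) * I)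

/-- The covering of `Region m n` by a star convex set. -/
noncomputable def coverFun (m n : ℕ) (e : ℂ × ℂ) : ℂ × ℂ := (e.1 * twist m n e.2, exp e.2)

/-- The star convex set that covers `Region m n`. -/
def Cover (n : ℕ) : Set (ℂ × ℂ) := {e | ‖e.1‖ < 1 ∨ -(e.1 ^ n) ∈ slitPlane}

theorem twist_ne_zero (l : ℂ) : twist m n l ≠ 0 := exp_ne_zero _

theorem norm_twist (l : ℂ) : ‖twist m n l‖ = Real.exp l.re := by
  rw [twist, norm_exp]
  have : (l.re + (m / n * l.im) * I : ℂ).re = l.re := by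
    have h : ((m / n * l.im : ℂ)) = ((m / n * l.im : ℝ) : ℂ) := by push_cast; ring
    rw [h]; simp
  rw [this]

theorem continuous_twist : Continuous (twist m n) := by
  unfold twist
  fun_prop

theorem continuous_coverFun : Continuous (coverFun m n) :=
  (continuous_fst.mul (continuous_twist.comp continuous_snd)).prodMk
    (continuous_exp.comp continuous_snd)

/-- The rotation speed `m / n` in `twist` makes the arguments of `twist ^ n` and of `conj (exp l) ^
m` cancel. Together with the modulus of `twist` this reduces membership in the region to a condition
on the first coordinate alone. -/
theorem slitForm_coverFun (hn : 0 < n) (e : ℂ × ℂ) :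
    slitForm m n (coverFun m n e) = (Real.exp ((n + m) * e.2.re) : ℝ) * -(e.1 ^ n) := by
  have hn' : (n : ℂ) ≠ 0 := by exact_mod_cast hn.ne'
  have h : twist m n e.2 ^ n * conj (exp e.2) ^ m = (Real.exp ((n + m) * e.2.re) : ℝ) := by
    rw [twist, ← exp_conj, ← exp_nat_mul, ← exp_nat_mul, ← exp_add, ofReal_exp]
    congr 1
    apply Complex.ext
    · simp; ring
    · simp; field_simp; ring
  rw [slitForm, coverFun, mul_pow, mul_assoc, h]
  ring

theorem coverFun_mem_Region (hn : 0 < n) (e : ℂ × ℂ) :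
    coverFun m n e ∈ Region m n ↔ e ∈ Cover n := by
  rw [Region, Cover, Set.mem_ofPred_eq, Set.mem_ofPred_eq, slitForm_coverFun hn,
    ofReal_mul_mem_slitPlane (Real.exp_pos _), coverFun, norm_mul, norm_twist, norm_exp]
  rw [mul_lt_iff_lt_one_left (Real.exp_pos _)]

/-- Shrinking by `a > 0` multiplies `-(e.1 ^ n)` by the positive real `a ^ n`, which preserves the
slit plane; `a = 0` lands in the other branch of the condition. -/
theorem starConvex_Cover : StarConvex ℝ 0 (Cover n) := by
  rw [starConvex_zero_iff]
  rintro e he a ha0 ha1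
  rcases ha0.eq_or_lt with rfl | ha
  · left; simp
  rcases he with h | h
  · left
    rw [Prod.smul_fst, norm_smul, Real.norm_of_nonneg ha0]
    exact (mul_le_of_le_one_left (norm_nonneg _) ha1).trans_lt h
  · right
    have : -((a • e).1 ^ n) = ((a ^ n : ℝ) : ℂ) * -(e.1 ^ n) := by
      rw [Prod.smul_fst, real_smul, mul_pow]; push_cast; ring
    rw [this, ofReal_mul_mem_slitPlane (pow_pos ha n)]
    exact h

instance : ContractibleSpace (Cover n) :=
  starConvex_Cover.contractibleSpace ⟨0, Or.inl (by simp)⟩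

theorem coverFun_of_exp_eq {z : ℂ × ℂ} {l : ℂ} (hl : exp l = z.2) :
    coverFun m n (z.1 / twist m n l, l) = z :=
  Prod.ext (div_mul_cancel₀ _ (twist_ne_zero l)) hl

/-- The deck transformations of the covering of `Region m n`. -/
noncomputable def deck (m n : ℕ) (k : ℤ) (e : ℂ × ℂ) : ℂ × ℂ :=
  (e.1 * exp (-(k * (2 * Real.pi * (m / n) * I))), e.2 + k * (2 * Real.pi * I))

theorem deck_add (j k : ℤ) (e : ℂ × ℂ) : deck m n (j + k) e = deck m n j (deck m n k e) := by
  refine Prod.ext ?_ ?_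
  · simp only [deck]
    rw [mul_assoc e.1, ← exp_add]
    congr 2
    push_cast; ring
  · simp only [deck]
    push_cast; ring

theorem twist_add (l : ℂ) (k : ℤ) : twist m n (l + k * (2 * Real.pi * I)) =
    twist m n l * exp (k * (2 * Real.pi * (m / n) * I)) := by
  rw [twist, twist, ← exp_add]
  have h : (k * (2 * Real.pi * I) : ℂ) = ((k * (2 * Real.pi) : ℝ) : ℂ) * I := by push_cast; ring
  rw [h, add_re, add_im, re_ofReal_mul, im_ofReal_mul, I_re, I_im]
  congr 1
  push_cast; ring

theorem coverFun_deck (k : ℤ) (e : ℂ × ℂ) : coverFun m n (deck m n k e) = coverFun m n e := by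
  refine Prod.ext ?_ ?_
  · simp only [coverFun, deck]
    rw [twist_add, mul_mul_mul_comm, mul_comm (exp _) (exp _), ← exp_add, add_neg_cancel, exp_zero,
      mul_one]
  · simp only [coverFun, deck]
    exact exp_periodic.int_mul k e.2

theorem continuous_deck (k : ℤ) : Continuous (deck m n k) := by
  unfold deck
  fun_prop

theorem exists_log_lift {f : C(unitInterval, ℂ)} (hf : ∀ t, f t ≠ 0) :
    ∃ l : C(unitInterval, ℂ), ∀ t, exp (l t) = f t := by
  obtain ⟨l, hl, -⟩ := isCoveringMap_exp.exists_path_lifts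
    ⟨fun t => (⟨f t, hf t⟩ : {z : ℂ // z ≠ 0}), by fun_prop⟩ (log (f 0))
    (Subtype.ext (exp_log (hf 0)).symm)
  exact ⟨l, fun t => congrArg Subtype.val (congrFun hl t)⟩

section Generator

-- The homeomorphism `h` is there so that one argument serves both sides: it is used for the
-- identity and for `swapModel`.
variable {Y : Type*} [TopologicalSpace Y] (h : Model m n ≃ₜ Y)

/-- The covering of the image of `Region m n` in `Y`. -/
noncomputable def coverMap (hn : 0 < n) : C(Cover n, Y) where
  toFun e := h ⟨coverFun m n e.1, Region_subset_Model ((coverFun_mem_Region hn _).2 e.2)⟩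
  continuous_toFun := h.continuous.comp
    ((continuous_coverFun.comp continuous_subtype_val).subtype_mk _)

theorem symm_coverMap (hn : 0 < n) (e : Cover n) :
    (h.symm (coverMap h hn e)).1 = coverFun m n e.1 := by
  simp [coverMap]

theorem coverMap_eq_iff (hn : 0 < n) (e : Cover n) (y : Y) :
    coverMap h hn e = y ↔ coverFun m n e.1 = (h.symm y).1 := by
  rw [← symm_coverMap h hn, ← Subtype.ext_iff, h.symm.injective.eq_iff]

theorem exists_coverMap_eq (hm : 0 < m) (hn : 0 < n) {y : Y} (hy : (h.symm y).1 ∈ Region m n) :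
    ∃ e, coverMap h hn e = y := by
  have he := coverFun_of_exp_eq (m := m) (n := n) (z := (h.symm y).1)
    (exp_log (snd_ne_zero_of_mem_Region hm hy))
  refine ⟨⟨_, (coverFun_mem_Region hn _).1 (he.symm ▸ hy)⟩, ?_⟩
  rw [coverMap_eq_iff]
  exact he

theorem exists_path_in_Region (hm : 0 < m) (hn : 0 < n) {y p : Y}
    (hy : (h.symm y).1 ∈ Region m n) (hp : (h.symm p).1 ∈ Region m n) :
    ∃ η : Path y p, ∀ t, (h.symm (η t)).1 ∈ Region m n := by
  obtain ⟨e, rfl⟩ := exists_coverMap_eq h hm hn hy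
  obtain ⟨e', rfl⟩ := exists_coverMap_eq h hm hn hp
  refine ⟨(PathConnectedSpace.somePath e e').map (coverMap h hn).continuous, fun t => ?_⟩
  rw [Path.map_coe, Function.comp_apply, symm_coverMap, coverFun_mem_Region hn]
  exact Subtype.coe_prop _

theorem exists_log_lift_of_Region (hm : 0 < m) {y : Y} (γ : Path y y)
    (hγ : ∀ t, (h.symm (γ t)).1 ∈ Region m n) :
    ∃ (l : C(unitInterval, ℂ)) (k : ℤ), (∀ t, exp (l t) = (h.symm (γ t)).1.2) ∧
      l 1 = l 0 + k * (2 * Real.pi * I) := by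
  obtain ⟨l, hl⟩ := exists_log_lift (f := ⟨fun t => (h.symm (γ t)).1.2, by fun_prop⟩)
    fun t => snd_ne_zero_of_mem_Region hm (hγ t)
  obtain ⟨k, hk⟩ := exp_eq_exp_iff_exists_int.1
    (show exp (l 1) = exp (l 0) by rw [hl, hl]; simp)
  exact ⟨l, k, hl, hk⟩

/-- The loops in the image of `Region m n` are powers of a single one, and the exponent is the
winding number of the second coordinate. -/
theorem exists_region_generator (hm : 0 < m) (hn : 0 < n) {y : Y}
    (hy : (h.symm y).1 ∈ Region m n) :
    ∃ x : FundamentalGroup Y y,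
      (∀ (γ : Path y y) (l : C(unitInterval, ℂ)) (k : ℤ), (∀ t, (h.symm (γ t)).1 ∈ Region m n) →
        (∀ t, exp (l t) = (h.symm (γ t)).1.2) → l 1 = l 0 + k * (2 * Real.pi * I) →
        Path.Homotopic.Quotient.mk γ = x ^ k) ∧
      ∃ (γ : Path y y) (l : C(unitInterval, ℂ)), (∀ t, (h.symm (γ t)).1 ∈ Region m n) ∧
        (∀ t, exp (l t) = (h.symm (γ t)).1.2) ∧ l 1 = l 0 + 2 * Real.pi * I := by
  obtain ⟨e₀, he₀⟩ := exists_coverMap_eq h hm hn hy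
  let F : ℤ → C(Cover n, Cover n) := fun k =>
    ⟨fun e => ⟨deck m n k e.1, (coverFun_mem_Region hn _).1 ((coverFun_deck (m := m) k e.1).symm ▸
      (coverFun_mem_Region hn _).2 e.2)⟩, by
      exact ((continuous_deck k).comp continuous_subtype_val).subtype_mk _⟩
  have hPF : ∀ k e, coverMap h hn (F k e) = coverMap h hn e := by
    intro k e
    rw [coverMap_eq_iff, symm_coverMap]
    exact coverFun_deck k e.1
  obtain ⟨x, hx⟩ := FundamentalGroup.exists_deck_generator (coverMap h hn) F
    (fun j k e => Subtype.ext (deck_add j k e.1)) hPF e₀ he₀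
  refine ⟨x, fun γ l k hγ hl hk => ?_, ?_⟩
  -- The logarithm `l` is shifted by the constant `c`, a multiple of `2πi`, so that the lift starts
  -- at `e₀`.
  · set c := e₀.1.2 - l 0 with hc
    have he₀' := (coverMap_eq_iff h hn e₀ y).1 he₀
    have hl' : ∀ t, exp (l t + c) = (h.symm (γ t)).1.2 := by
      intro t
      rw [exp_add, hl, hc, exp_sub, hl 0, γ.source, ← he₀']
      simp [coverFun]
    have hcov : ∀ t, coverFun m n ((h.symm (γ t)).1.1 / twist m n (l t + c), l t + c) =
        (h.symm (γ t)).1 := fun t => coverFun_of_exp_eq (hl' t)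
    let δ : C(unitInterval, Cover n) :=
      ⟨fun t => ⟨((h.symm (γ t)).1.1 / twist m n (l t + c), l t + c),
        (coverFun_mem_Region hn _).1 ((hcov t).symm ▸ hγ t)⟩, by
        refine Continuous.subtype_mk (Continuous.prodMk ?_ (by fun_prop)) _
        refine Continuous.div (by fun_prop) ?_ fun t => twist_ne_zero _
        exact continuous_twist.comp (by fun_prop)⟩
    have h0 : δ 0 = e₀ := by
      refine Subtype.ext (Prod.ext ?_ ?_)
      · change (h.symm (γ 0)).1.1 / twist m n (l 0 + c) = e₀.1.1
        rw [γ.source, ← he₀', hc, add_sub_cancel, coverFun,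
            mul_div_cancel_right₀ _ (twist_ne_zero _)]
      · change l 0 + c = e₀.1.2
        rw [hc, add_sub_cancel]
    refine hx k γ δ h0 ?_ fun t => (coverMap_eq_iff h hn _ _).2 (hcov t)
    rw [← h0]
    have hl1 : l 1 + c = l 0 + c + k * (2 * Real.pi * I) := by rw [hk]; ring
    refine Subtype.ext (Prod.ext ?_ ?_)
    · change (h.symm (γ 1)).1.1 / twist m n (l 1 + c) =
        (h.symm (γ 0)).1.1 / twist m n (l 0 + c) * exp (-(k * (2 * Real.pi * (m / n) * I)))
      rw [hl1, twist_add, γ.source, γ.target, exp_neg, div_mul_eq_div_div, div_eq_mul_inv _ (exp _)]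
    · exact hl1
  · let η := PathConnectedSpace.somePath e₀ (F 1 e₀)
    refine ⟨(η.map (coverMap h hn).continuous).cast he₀.symm (by rw [hPF, he₀]),
      ⟨fun t => (η t).1.2, by fun_prop⟩, fun t => ?_, fun t => ?_, ?_⟩
    · rw [Path.cast_coe, Path.map_coe, Function.comp_apply, symm_coverMap, coverFun_mem_Region hn]
      exact Subtype.coe_prop _
    · rw [Path.cast_coe, Path.map_coe, Function.comp_apply, symm_coverMap]
      rfl
    · have : (η 1).1.2 = (η 0).1.2 + (1 : ℤ) * (2 * Real.pi * I) := by
        rw [η.target, η.source]; rfl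
      simpa using this

end Generator

end TorusModel

/-! ### The local system attached to `A ^ n = B ^ m` -/

namespace TorusModel

open Complex Topology ComplexConjugate

variable {m n : ℕ}

theorem neg_exp_mem_slitPlane {t : ℝ} (h0 : 0 < t) (h1 : t < 2 * Real.pi) :
    -exp (t * I) ∈ slitPlane := by
  have h : -exp (t * I) = exp (((t - Real.pi : ℝ) : ℂ) * I) := by
    push_cast
    rw [sub_mul, exp_sub, exp_pi_mul_I]
    ring
  rw [h, exp_mem_slitPlane]
  have him : (((t - Real.pi : ℝ) : ℂ) * I).im = t - Real.pi := by simp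
  rw [him, (toIocMod_eq_self Real.two_pi_pos).2]
  · linarith
  · constructor <;> linarith

theorem ne_two_pi_mul_of_neg_exp_mem_slitPlane {t : ℝ} (h : -exp (t * I) ∈ slitPlane) (k : ℤ) :
    t ≠ k * (2 * Real.pi) := by
  rintro rfl
  have h1 : exp (((k * (2 * Real.pi) : ℝ) : ℂ) * I) = 1 := by
    rw [exp_eq_one_iff]
    exact ⟨k, by push_cast; ring⟩
  rw [h1] at h
  have h2 := neg_ofReal_mem_slitPlane.1 (show -((1 : ℝ) : ℂ) ∈ slitPlane by simpa using h)
  linarith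

theorem slitForm_exp_mem (a b : ℂ) : slitForm m n (exp a, exp b) ∈ slitPlane ↔
    -exp ((n * a.im - m * b.im : ℝ) * I) ∈ slitPlane := by
  have h : slitForm m n (exp a, exp b) =
      (Real.exp (n * a.re + m * b.re) : ℝ) * -exp ((n * a.im - m * b.im : ℝ) * I) := by
    rw [slitForm, ← exp_conj, ← exp_nat_mul, ← exp_nat_mul, ← exp_add, ofReal_exp, mul_neg,
      ← exp_add]
    congr 2
    apply Complex.ext <;> simp; ring
  rw [h, ofReal_mul_mem_slitPlane (Real.exp_pos _)]

theorem slitForm_exp_mem_of_pos {a b : ℂ} (h0 : 0 < n * a.im - m * b.im)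
    (h1 : n * a.im - m * b.im < 2 * Real.pi) : slitForm m n (exp a, exp b) ∈ slitPlane :=
  (slitForm_exp_mem a b).2 (neg_exp_mem_slitPlane h0 h1)

/-- Points in the slit region have logarithms in a convex set. -/
theorem exists_logs (hm : 0 < m) (hn : 0 < n) (hco : m.Coprime n) {z : ℂ × ℂ}
    (hz : slitForm m n z ∈ slitPlane) : ∃ a b : ℂ, exp a = z.1 ∧ exp b = z.2 ∧
      0 < n * a.im - m * b.im ∧ n * a.im - m * b.im < 2 * Real.pi := by
  obtain ⟨z₁, z₂⟩ := z
  have h1 := exp_log (fst_ne_zero_of_slitForm hn hz)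
  have h2 := exp_log (snd_ne_zero_of_slitForm hm hz)
  simp only at h1 h2
  rw [← h1, ← h2, slitForm_exp_mem] at hz
  set t : ℝ := n * (log z₁).im - m * (log z₂).im with ht
  have hne := ne_two_pi_mul_of_neg_exp_mem_slitPlane hz ⌊t / (2 * Real.pi)⌋
  set K := ⌊t / (2 * Real.pi)⌋ with hK
  have hle : K * (2 * Real.pi) ≤ t := (le_div_iff₀ Real.two_pi_pos).1 (Int.floor_le _)
  have hlt : t < (K + 1) * (2 * Real.pi) := (div_lt_iff₀ Real.two_pi_pos).1 (Int.lt_floor_add_one _)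
  -- By Bézout, subtracting `K * gcdB` turns from the first argument and adding `K * gcdA` turns to
  -- the second lowers the combination by exactly `K` turns.
  have hbez : (1 : ℝ) = m * (m.gcdA n : ℤ) + n * (m.gcdB n : ℤ) := by
    have := Nat.gcd_eq_gcd_ab m n
    rw [hco.gcd_eq_one] at this
    exact_mod_cast this
  have key : ∀ k : ℤ, exp ((k : ℝ) * (2 * Real.pi) * I : ℂ) = 1 := fun k => by
    rw [exp_eq_one_iff]; exact ⟨k, by push_cast; ring⟩
  have hshift : n * ((log z₁).im - (K * m.gcdB n : ℤ) * (2 * Real.pi)) -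
      m * ((log z₂).im + (K * m.gcdA n : ℤ) * (2 * Real.pi)) = t - K * (2 * Real.pi) := by
    rw [ht]; push_cast
    linear_combination (K * (2 * Real.pi)) * hbez
  refine ⟨log z₁ - ((K * m.gcdB n : ℤ) : ℝ) * (2 * Real.pi) * I,
    log z₂ + ((K * m.gcdA n : ℤ) : ℝ) * (2 * Real.pi) * I, ?_, ?_, ?_, ?_⟩
  · rw [exp_sub, h1, key, div_one]
  · rw [exp_add, h2, key, mul_one]
  all_goals
    have him1 : (log z₁ - ((K * m.gcdB n : ℤ) : ℝ) * (2 * Real.pi) * I).im =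
        (log z₁).im - (K * m.gcdB n : ℤ) * (2 * Real.pi) := by simp
    have him2 : (log z₂ + ((K * m.gcdA n : ℤ) : ℝ) * (2 * Real.pi) * I).im =
        (log z₂).im + (K * m.gcdA n : ℤ) * (2 * Real.pi) := by simp
    rw [him1, him2, hshift]
  · exact sub_pos.2 (lt_of_le_of_ne hle hne.symm)
  · linarith

/-- `t` is an argument of `z`. -/
def IsArg (z : ℂ) (t : ℝ) : Prop := z = ‖z‖ * exp (t * I)

theorem isArg_im {z a : ℂ} (h : exp a = z) : IsArg z a.im := by
  subst h
  rw [IsArg, norm_exp, ofReal_exp, ← exp_add, re_add_im]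

theorem isArg_arg (z : ℂ) : IsArg z z.arg := (norm_mul_exp_arg_mul_I z).symm

/-- The argument function with a branch cut opposite to the direction `θ`. -/
noncomputable def angle (θ : ℝ) (z : ℂ) : ℝ := (exp (-θ * I) * z).arg + θ

theorem isArg_angle (θ : ℝ) (z : ℂ) : IsArg z (angle θ z) := by
  have h := isArg_arg (exp (-θ * I) * z)
  rw [IsArg, norm_mul] at h
  have h1 : ‖exp (-θ * I)‖ = 1 := by
    have := norm_exp_ofReal_mul_I (-θ); push_cast at this; exact this
  rw [h1, one_mul] at h
  rw [IsArg, angle]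
  push_cast
  rw [add_mul, exp_add, ← mul_assoc, ← h, mul_right_comm, ← exp_add]
  simp

theorem continuousAt_angle {θ : ℝ} {z : ℂ} (h : exp (-θ * I) * z ∈ slitPlane) :
    ContinuousAt (angle θ) z := by
  unfold angle
  refine ContinuousAt.add ?_ continuousAt_const
  exact ContinuousAt.comp (f := fun z => exp (-θ * I) * z) (continuousAt_arg h) (by fun_prop)

theorem exp_neg_arg_mul_mem_slitPlane {z : ℂ} (hz : z ≠ 0) :
    exp (-z.arg * I) * z ∈ slitPlane := by
  have h : exp (-z.arg * I) * z = (‖z‖ : ℝ) := by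
    conv_lhs => rw [← norm_mul_exp_arg_mul_I z]
    rw [arg_real_mul _ (norm_pos_iff.2 hz), arg_exp_mul_I, (toIocMod_eq_self Real.two_pi_pos).2]
    · rw [mul_left_comm, ← exp_add]; simp
    · have := arg_mem_Ioc z
      constructor <;> linarith [this.1, this.2]
  rw [h, ofReal_mem_slitPlane]
  exact norm_pos_iff.2 hz

/-- The integer `k` such that `t = 2πk`. -/
noncomputable def turns (t : ℝ) : ℤ := round (t / (2 * Real.pi))

theorem turns_mul (k : ℤ) : turns (k * (2 * Real.pi)) = k := by
  rw [turns, mul_div_cancel_right₀ _ Real.two_pi_pos.ne', round_intCast]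

theorem IsArg.sub_eq {z : ℂ} (hz : z ≠ 0) {s t : ℝ} (hs : IsArg z s) (ht : IsArg z t) :
    s - t = turns (s - t) * (2 * Real.pi) := by
  have h : exp (s * I) = exp (t * I) := by
    rw [IsArg] at hs ht
    have h0 : (‖z‖ : ℂ) ≠ 0 := by exact_mod_cast norm_ne_zero_iff.2 hz
    exact mul_left_cancel₀ h0 (hs.symm.trans ht)
  obtain ⟨k, hk⟩ := exp_eq_exp_iff_exists_int.1 h
  have h2 : (s : ℂ) = ((t + k * (2 * Real.pi) : ℝ) : ℂ) := by
    apply mul_right_cancel₀ I_ne_zero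
    rw [hk]; push_cast; ring
  have h3 : s - t = k * (2 * Real.pi) := by
    rw [ofReal_inj.1 h2]; ring
  rw [h3, turns_mul]

theorem IsArg.turns_add {z : ℂ} (hz : z ≠ 0) {r s t : ℝ} (hr : IsArg z r) (hs : IsArg z s)
    (ht : IsArg z t) : turns (r - s) + turns (s - t) = turns (r - t) := by
  rw [← turns_mul (turns (r - s) + turns (s - t))]
  push_cast
  rw [add_mul, ← hr.sub_eq hz hs, ← hs.sub_eq hz ht]
  congr 1
  ring

theorem IsArg.turns_neg {z : ℂ} (hz : z ≠ 0) {r s : ℝ} (hr : IsArg z r) (hs : IsArg z s) :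
    -turns (r - s) = turns (s - r) := by
  have := hr.turns_add hz hs hr
  have h0 : turns 0 = 0 := by simp [turns]
  rw [sub_self, h0] at this
  omega

/-- Multiples of `2π` at distance less than `2π` coincide. -/
theorem eventually_turns_eq {X : Type*} [TopologicalSpace X] {f : X → ℝ} {x : X}
    (hf : ContinuousAt f x) (h : ∀ᶠ y in 𝓝 x, f y = turns (f y) * (2 * Real.pi)) :
    ∀ᶠ y in 𝓝 x, turns (f y) = turns (f x) := by
  filter_upwards [h, Metric.continuousAt_iff'.1 hf (2 * Real.pi) Real.two_pi_pos] with y hy hd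
  rw [Real.dist_eq, hy, h.self_of_nhds, ← sub_mul, abs_mul, abs_of_pos Real.two_pi_pos,
    mul_lt_iff_lt_one_left Real.two_pi_pos] at hd
  have : |turns (f y) - turns (f x)| < 1 := by exact_mod_cast hd
  rw [Int.abs_lt_one_iff] at this
  omega

/-- Reference arguments of the two coordinates, chosen coherently on the slit region. -/
theorem exists_reference (hm : 0 < m) (hn : 0 < n) (hco : m.Coprime n) (z : ℂ × ℂ) :
    ∃ α β : ℝ, IsArg z.1 α ∧ IsArg z.2 β ∧ (slitForm m n z ∈ slitPlane →
      0 < n * α - m * β ∧ n * α - m * β < 2 * Real.pi) := by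
  by_cases hz : slitForm m n z ∈ slitPlane
  · obtain ⟨a, b, ha, hb, h⟩ := exists_logs hm hn hco hz
    exact ⟨a.im, b.im, isArg_im ha, isArg_im hb, fun _ => h⟩
  · exact ⟨_, _, isArg_arg _, isArg_arg _, fun h => absurd h hz⟩

theorem slitForm_mem_of_Region_of_swap {z : ℂ × ℂ} (h : z ∈ Region m n)
    (h' : z.swap ∈ Region n m) : slitForm m n z ∈ slitPlane := by
  rcases h with h | h
  · rcases h' with h' | h'
    · exact absurd h h'.not_gt
    · exact (slitForm_swap_mem z).1 h'
  · exact h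

theorem mem_Region_or_swap {z : ℂ × ℂ} (h : z ∈ Model m n) :
    z ∈ Region m n ∨ z.swap ∈ Region n m := by
  rcases h with h | h | h
  exacts [Or.inl (Or.inl h), Or.inr (Or.inl h), Or.inl (Or.inr h)]

/-- By coprimality `(r, s)` and `(r', s')` differ by a multiple of `(m, n)`, and `B ^ m = A ^ n`
cancels it. This is the only place where the relation enters the cocycle condition. -/
theorem zpow_mul_inv_zpow_eq {Γ : Type*} [Group Γ] {A B : Γ} (hm : 0 < m) (hco : m.Coprime n)
    (hAB : A ^ n = B ^ m) {r s r' s' : ℤ} (h : n * r - m * s = n * r' - m * s') :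
    B ^ r * (A ^ s)⁻¹ = B ^ r' * (A ^ s')⁻¹ := by
  have h1 : (m : ℤ) ∣ n * (r - r') := ⟨s - s', by linarith⟩
  obtain ⟨j, hj⟩ := (Nat.isCoprime_iff_coprime.2 hco).dvd_of_dvd_mul_left h1
  have h2 : s - s' = n * j := by
    have h3 : (m : ℤ) * (s - s') = m * (n * j) := by
      have : (m : ℤ) * (s - s') = n * (r - r') := by linarith
      rw [this, hj]; ring
    exact mul_left_cancel₀ (by exact_mod_cast hm.ne') h3
  have hr : r = r' + m * j := by linarith
  have hs : s = n * j + s' := by linarith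
  have hc : B ^ ((m : ℤ) * j) = A ^ ((n : ℤ) * j) := by
    rw [zpow_mul, zpow_mul, zpow_natCast, zpow_natCast, hAB]
  rw [hr, hs, zpow_add, hc, ← zpow_neg, ← zpow_neg, mul_assoc, ← zpow_add]
  congr 2
  ring

/-- The sets of the open cover used to define the local system. -/
def chart (m n : ℕ) : ℝ ⊕ ℝ → Set (Model m n)
  | .inl θ => {p | p.1 ∈ Region m n ∧ exp (-θ * I) * p.1.2 ∈ slitPlane}
  | .inr θ => {p | p.1.swap ∈ Region n m ∧ exp (-θ * I) * p.1.1 ∈ slitPlane}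

theorem isOpen_chart (i : ℝ ⊕ ℝ) : IsOpen (chart m n i) := by
  rcases i with θ | θ
  · exact (isOpen_Region.preimage continuous_subtype_val).inter
      (isOpen_slitPlane.preimage (f := fun p : Model m n => exp (-θ * I) * p.1.2) (by fun_prop))
  · exact (isOpen_Region.preimage (continuous_swap.comp continuous_subtype_val)).inter
      (isOpen_slitPlane.preimage (f := fun p : Model m n => exp (-θ * I) * p.1.1) (by fun_prop))

/-- The local frames of the local system. -/
noncomputable def frame {Γ : Type*} [Group Γ] (A B : Γ) (α β : Model m n → ℝ) :
    ℝ ⊕ ℝ → Model m n → Γ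
  | .inl θ => fun p => A ^ turns (β p - angle θ p.1.2)
  | .inr θ => fun p => B ^ turns (α p - angle θ p.1.1)

section LocalSystem

variable {Γ : Type*} [Group Γ] {A B : Γ} {α β : Model m n → ℝ}

/-- The reference argument `β`, which need not be continuous, cancels; what remains counts the turns
between two branches of the argument that are continuous near `x`. -/
theorem eventually_frame_inl (hm : 0 < m) (hβ : ∀ p, IsArg p.1.2 (β p)) {θ θ' : ℝ}
    {x : Model m n} (hx : x ∈ chart m n (.inl θ)) (hx' : x ∈ chart m n (.inl θ')) :
    ∀ᶠ p in 𝓝 x, frame A B α β (.inl θ') p * (frame A B α β (.inl θ) p)⁻¹ =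
      frame A B α β (.inl θ') x * (frame A B α β (.inl θ) x)⁻¹ := by
  have hz : ∀ p ∈ chart m n (.inl θ), p.1.2 ≠ 0 := fun p hp => snd_ne_zero_of_mem_Region hm hp.1
  have heq : ∀ p ∈ chart m n (.inl θ), frame A B α β (.inl θ') p * (frame A B α β (.inl θ) p)⁻¹ =
      A ^ turns (angle θ p.1.2 - angle θ' p.1.2) := by
    intro p hp
    simp only [frame]
    rw [← zpow_neg, ← zpow_add, (hβ p).turns_neg (hz p hp) (isArg_angle _ _), add_comm,
      (isArg_angle _ _).turns_add (hz p hp) (hβ p) (isArg_angle _ _)]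
  have hev := (isOpen_chart (.inl θ)).mem_nhds hx
  have hc : ContinuousAt (fun p : Model m n => angle θ p.1.2 - angle θ' p.1.2) x :=
    (ContinuousAt.comp (f := fun p : Model m n => p.1.2) (continuousAt_angle hx.2)
      (by fun_prop)).sub
    (ContinuousAt.comp (f := fun p : Model m n => p.1.2) (continuousAt_angle hx'.2) (by fun_prop))
  filter_upwards [hev, eventually_turns_eq hc (by
    filter_upwards [hev] with p hp
    exact (isArg_angle _ _).sub_eq (hz p hp) (isArg_angle _ _))] with p hp ht
  rw [heq p hp, heq x hx, ht]

theorem eventually_frame_inr (hn : 0 < n) (hα : ∀ p, IsArg p.1.1 (α p)) {θ θ' : ℝ}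
    {x : Model m n} (hx : x ∈ chart m n (.inr θ)) (hx' : x ∈ chart m n (.inr θ')) :
    ∀ᶠ p in 𝓝 x, frame A B α β (.inr θ') p * (frame A B α β (.inr θ) p)⁻¹ =
      frame A B α β (.inr θ') x * (frame A B α β (.inr θ) x)⁻¹ := by
  have hz : ∀ p ∈ chart m n (.inr θ), p.1.1 ≠ 0 := fun p hp => snd_ne_zero_of_mem_Region hn hp.1
  have heq : ∀ p ∈ chart m n (.inr θ), frame A B α β (.inr θ') p * (frame A B α β (.inr θ) p)⁻¹ =
      B ^ turns (angle θ p.1.1 - angle θ' p.1.1) := by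
    intro p hp
    simp only [frame]
    rw [← zpow_neg, ← zpow_add, (hα p).turns_neg (hz p hp) (isArg_angle _ _), add_comm,
      (isArg_angle _ _).turns_add (hz p hp) (hα p) (isArg_angle _ _)]
  have hev := (isOpen_chart (.inr θ)).mem_nhds hx
  have hc : ContinuousAt (fun p : Model m n => angle θ p.1.1 - angle θ' p.1.1) x :=
    (ContinuousAt.comp (f := fun p : Model m n => p.1.1) (continuousAt_angle hx.2)
      (by fun_prop)).sub
    (ContinuousAt.comp (f := fun p : Model m n => p.1.1) (continuousAt_angle hx'.2) (by fun_prop))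
  filter_upwards [hev, eventually_turns_eq hc (by
    filter_upwards [hev] with p hp
    exact (isArg_angle _ _).sub_eq (hz p hp) (isArg_angle _ _))] with p hp ht
  rw [heq p hp, heq x hx, ht]

/-- The transition depends only on the integer `K`. By the choice of `α` and `β`, adding `2πK` to a
continuous function gives a value in `(0, 2π)`, an interval too short for `K` to jump near `x`. -/
theorem eventually_frame_inl_inr (hm : 0 < m) (hn : 0 < n) (hco : m.Coprime n)
    (hAB : A ^ n = B ^ m) (hα : ∀ p, IsArg p.1.1 (α p)) (hβ : ∀ p, IsArg p.1.2 (β p))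
    (hαβ : ∀ p : Model m n, slitForm m n p.1 ∈ slitPlane →
      0 < n * α p - m * β p ∧ n * α p - m * β p < 2 * Real.pi) {θ φ : ℝ}
    {x : Model m n} (hx : x ∈ chart m n (.inl θ)) (hx' : x ∈ chart m n (.inr φ)) :
    ∀ᶠ p in 𝓝 x, frame A B α β (.inr φ) p * (frame A B α β (.inl θ) p)⁻¹ =
      frame A B α β (.inr φ) x * (frame A B α β (.inl θ) x)⁻¹ := by
  have hc : ContinuousAt (fun p : Model m n => n * angle φ p.1.1 - m * angle θ p.1.2) x :=
    ((ContinuousAt.comp (f := fun p : Model m n => p.1.1) (continuousAt_angle hx'.2)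
      (by fun_prop)).const_mul _).sub
    ((ContinuousAt.comp (f := fun p : Model m n => p.1.2) (continuousAt_angle hx.2)
      (by fun_prop)).const_mul _)
  let K : Model m n → ℤ := fun p =>
    n * turns (α p - angle φ p.1.1) - m * turns (β p - angle θ p.1.2)
  have hK : ∀ p, p ∈ chart m n (.inl θ) → p ∈ chart m n (.inr φ) →
      0 < K p * (2 * Real.pi) + (n * angle φ p.1.1 - m * angle θ p.1.2) ∧
      K p * (2 * Real.pi) + (n * angle φ p.1.1 - m * angle θ p.1.2) < 2 * Real.pi := by
    intro p hp hp'
    have h1 := (hα p).sub_eq (snd_ne_zero_of_mem_Region hn hp'.1) (isArg_angle φ p.1.1)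
    have h2 := (hβ p).sub_eq (snd_ne_zero_of_mem_Region hm hp.1) (isArg_angle θ p.1.2)
    have h3 : K p * (2 * Real.pi) + (n * angle φ p.1.1 - m * angle θ p.1.2) =
        n * α p - m * β p := by
      simp only [K]
      push_cast
      linear_combination (-(n : ℝ)) * h1 + (m : ℝ) * h2
    rw [h3]
    exact hαβ p (slitForm_mem_of_Region_of_swap hp.1 hp'.1)
  have hKx := hK x hx hx'
  have hev : ∀ᶠ p in 𝓝 x, K x * (2 * Real.pi) + (n * angle φ p.1.1 - m * angle θ p.1.2) ∈
      Set.Ioo 0 (2 * Real.pi) :=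
    (ContinuousAt.add continuousAt_const hc) (isOpen_Ioo.mem_nhds hKx)
  filter_upwards [hev, (isOpen_chart (.inl θ)).mem_nhds hx, (isOpen_chart (.inr φ)).mem_nhds hx']
    with p hp hpl hpr
  have hKp := hK p hpl hpr
  refine zpow_mul_inv_zpow_eq hm hco hAB ?_
  change K p = K x
  have hpi := Real.two_pi_pos
  have h1 : (K p : ℝ) < K x + 1 := by
    refine lt_of_mul_lt_mul_right ?_ hpi.le
    linarith [hKp.2, hp.1]
  have h2 : (K x : ℝ) < K p + 1 := by
    refine lt_of_mul_lt_mul_right ?_ hpi.le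
    linarith [hKp.1, hp.2]
  have h3 : K p < K x + 1 := by exact_mod_cast h1
  have h4 : K x < K p + 1 := by exact_mod_cast h2
  omega

theorem eventually_frame (hm : 0 < m) (hn : 0 < n) (hco : m.Coprime n)
    (hAB : A ^ n = B ^ m) (hα : ∀ p, IsArg p.1.1 (α p)) (hβ : ∀ p, IsArg p.1.2 (β p))
    (hαβ : ∀ p : Model m n, slitForm m n p.1 ∈ slitPlane →
      0 < n * α p - m * β p ∧ n * α p - m * β p < 2 * Real.pi) (i j : ℝ ⊕ ℝ) (x : Model m n)
    (hx : x ∈ chart m n i ∩ chart m n j) :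
    ∀ᶠ p in 𝓝 x, frame A B α β j p * (frame A B α β i p)⁻¹ =
      frame A B α β j x * (frame A B α β i x)⁻¹ := by
  rcases i with θ | θ <;> rcases j with φ | φ
  · exact eventually_frame_inl hm hβ hx.1 hx.2
  · exact eventually_frame_inl_inr hm hn hco hAB hα hβ hαβ hx.1 hx.2
  · filter_upwards [eventually_frame_inl_inr hm hn hco hAB hα hβ hαβ hx.2 hx.1] with p hp
    have := congrArg (·⁻¹) hp
    simpa only [mul_inv_rev, inv_inv] using this
  · exact eventually_frame_inr hn hα hx.1 hx.2

theorem exists_chart (hm : 0 < m) (hn : 0 < n) (p : Model m n) : ∃ i, p ∈ chart m n i := by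
  rcases mem_Region_or_swap p.2 with h | h
  · exact ⟨.inl p.1.2.arg, h, exp_neg_arg_mul_mem_slitPlane (snd_ne_zero_of_mem_Region hm h)⟩
  · exact ⟨.inr p.1.1.arg, h, exp_neg_arg_mul_mem_slitPlane (snd_ne_zero_of_mem_Region hn h)⟩

/-- In a chart the reference argument cancels, leaving the turns between the continuous logarithm
`l` and a continuous branch of the argument. A loop winding once therefore has monodromy `A`. -/
theorem isFlat_inl (hm : 0 < m) (hβ : ∀ p, IsArg p.1.2 (β p)) {y : Model m n} (γ : Path y y)
    (l : C(unitInterval, ℂ)) (hγ : ∀ t, (γ t).1 ∈ Region m n) (hl : ∀ t, exp (l t) = (γ t).1.2) :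
    CechMonodromy.IsFlat (chart m n) (frame A B α β) γ
      fun t => A ^ turns ((l t).im - β (γ t)) := by
  intro t
  have hz : ∀ s, (γ s).1.2 ≠ 0 := fun s => snd_ne_zero_of_mem_Region hm (hγ s)
  have hmem : exp (-(γ t).1.2.arg * I) * (γ t).1.2 ∈ slitPlane :=
    exp_neg_arg_mul_mem_slitPlane (hz t)
  refine ⟨.inl (γ t).1.2.arg, ⟨hγ t, hmem⟩, ?_⟩
  generalize (γ t).1.2.arg = θ at hmem ⊢
  have heq : ∀ s, frame A B α β (.inl θ) (γ s) * A ^ turns ((l s).im - β (γ s)) =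
      A ^ turns ((l s).im - angle θ (γ s).1.2) := by
    intro s
    simp only [frame]
    rw [← zpow_add, add_comm, (isArg_im (hl s)).turns_add (hz s) (hβ _) (isArg_angle _ _)]
  have hc : ContinuousAt (fun s => (l s).im - angle θ (γ s).1.2) t :=
    ContinuousAt.sub (by fun_prop) (ContinuousAt.comp (f := fun s => (γ s).1.2)
      (continuousAt_angle hmem) (by fun_prop))
  filter_upwards [eventually_turns_eq hc (Filter.Eventually.of_forall fun s =>
    (isArg_im (hl s)).sub_eq (hz s) (isArg_angle _ _))] with s hs
  rw [heq, heq, hs]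

theorem isFlat_inr (hn : 0 < n) (hα : ∀ p, IsArg p.1.1 (α p)) {y : Model m n} (γ : Path y y)
    (l : C(unitInterval, ℂ)) (hγ : ∀ t, (γ t).1.swap ∈ Region n m)
    (hl : ∀ t, exp (l t) = (γ t).1.1) :
    CechMonodromy.IsFlat (chart m n) (frame A B α β) γ
      fun t => B ^ turns ((l t).im - α (γ t)) := by
  intro t
  have hz : ∀ s, (γ s).1.1 ≠ 0 := fun s => snd_ne_zero_of_mem_Region hn (hγ s)
  have hmem : exp (-(γ t).1.1.arg * I) * (γ t).1.1 ∈ slitPlane :=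
    exp_neg_arg_mul_mem_slitPlane (hz t)
  refine ⟨.inr (γ t).1.1.arg, ⟨hγ t, hmem⟩, ?_⟩
  generalize (γ t).1.1.arg = θ at hmem ⊢
  have heq : ∀ s, frame A B α β (.inr θ) (γ s) * B ^ turns ((l s).im - α (γ s)) =
      B ^ turns ((l s).im - angle θ (γ s).1.1) := by
    intro s
    simp only [frame]
    rw [← zpow_add, add_comm, (isArg_im (hl s)).turns_add (hz s) (hα _) (isArg_angle _ _)]
  have hc : ContinuousAt (fun s => (l s).im - angle θ (γ s).1.1) t :=
    ContinuousAt.sub (by fun_prop) (ContinuousAt.comp (f := fun s => (γ s).1.1)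
      (continuousAt_angle hmem) (by fun_prop))
  filter_upwards [eventually_turns_eq hc (Filter.Eventually.of_forall fun s =>
    (isArg_im (hl s)).sub_eq (hz s) (isArg_angle _ _))] with s hs
  rw [heq, heq, hs]

end LocalSystem

theorem turns_sub_turns_of_loop {z l₀ l₁ : ℂ} {t : ℝ} (hz : z ≠ 0) (h0 : exp l₀ = z)
    (h1 : exp l₁ = z) (h : l₁ = l₀ + 2 * Real.pi * I) (ht : IsArg z t) :
    turns (l₁.im - t) + -turns (l₀.im - t) = 1 := by
  rw [(isArg_im h0).turns_neg hz ht, (isArg_im h1).turns_add hz ht (isArg_im h0)]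
  have h2 : l₁.im - l₀.im = (1 : ℤ) * (2 * Real.pi) := by rw [h]; simp
  rw [h2, turns_mul]

/-- The homomorphism to a group with elements `A` and `B` such that `A ^ n = B ^ m`. -/
theorem exists_hom (hm : 0 < m) (hn : 0 < n) (hco : m.Coprime n) {Γ : Type*} [Group Γ] (A B : Γ)
    (hAB : A ^ n = B ^ m) (y : Model m n) :
    ∃ Φ : FundamentalGroup (Model m n) y →* Γ,
      (∀ (γ : Path y y) (l : C(unitInterval, ℂ)), (∀ t, (γ t).1 ∈ Region m n) →
        (∀ t, exp (l t) = (γ t).1.2) → l 1 = l 0 + 2 * Real.pi * I →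
        Φ (Path.Homotopic.Quotient.mk γ) = A) ∧
      ∀ (γ : Path y y) (l : C(unitInterval, ℂ)), (∀ t, (γ t).1.swap ∈ Region n m) →
        (∀ t, exp (l t) = (γ t).1.1) → l 1 = l 0 + 2 * Real.pi * I →
        Φ (Path.Homotopic.Quotient.mk γ) = B := by
  choose α β hα hβ hαβ using fun p : Model m n => exists_reference hm hn hco p.1
  obtain ⟨Φ, hΦ⟩ := exists_hom_of_cech isOpen_chart (exists_chart hm hn)
    (eventually_frame hm hn hco hAB hα hβ hαβ) y
  refine ⟨Φ, fun γ l hγ hl h => ?_, fun γ l hγ hl h => ?_⟩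
  · rw [hΦ γ _ (isFlat_inl hm hβ γ l hγ hl), ← zpow_neg, ← zpow_add, γ.source, γ.target,
      turns_sub_turns_of_loop (snd_ne_zero_of_mem_Region hm (γ.source ▸ hγ 0))
        (γ.source ▸ hl 0) (γ.target ▸ hl 1) h (hβ y), zpow_one]
  · have hy : y.1.swap ∈ Region n m := by simpa using hγ 0
    rw [hΦ γ _ (isFlat_inr hn hα γ l hγ hl), ← zpow_neg, ← zpow_add, γ.source, γ.target,
      turns_sub_turns_of_loop (z := y.1.1) (snd_ne_zero_of_mem_Region hn hy)
        (γ.source ▸ hl 0) (γ.target ▸ hl 1) h (hα y), zpow_one]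

end TorusModel

/-! ### Presentation of the fundamental group of the model -/

namespace TorusModel

open Complex Topology ComplexConjugate

variable {m n : ℕ}

/-- The set of pairs of logarithms of points of the slit region. -/
def LogRegion (m n : ℕ) : Set (ℂ × ℂ) := {c | n * c.1.im - m * c.2.im ∈ Set.Ioo 0 (2 * Real.pi)}

theorem convex_LogRegion : Convex ℝ (LogRegion m n) := by
  refine (convex_Ioo (0 : ℝ) (2 * Real.pi)).is_linear_preimage
    (f := fun c : ℂ × ℂ => n * c.1.im - m * c.2.im) ⟨fun c d => ?_, fun r c => ?_⟩
  · simp only [Prod.fst_add, Prod.snd_add, add_im]; ring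
  · simp only [Prod.smul_fst, Prod.smul_snd, real_smul, im_ofReal_mul, smul_eq_mul]; ring

/-- Exponentiation, from pairs of logarithms to the model. -/
noncomputable def expMap (m n : ℕ) : C(LogRegion m n, Model m n) where
  toFun c := ⟨(exp c.1.1, exp c.1.2), Or.inr (Or.inr (slitForm_exp_mem_of_pos c.2.1 c.2.2))⟩
  continuous_toFun := by fun_prop

theorem slitForm_expMap (c : LogRegion m n) : slitForm m n (expMap m n c).1 ∈ slitPlane :=
  slitForm_exp_mem_of_pos c.2.1 c.2.2

theorem exists_expMap_eq (hm : 0 < m) (hn : 0 < n) (hco : m.Coprime n) {p : Model m n}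
    (hp : slitForm m n p.1 ∈ slitPlane) : ∃ c, expMap m n c = p := by
  obtain ⟨a, b, ha, hb, h⟩ := exists_logs hm hn hco hp
  exact ⟨⟨(a, b), h⟩, Subtype.ext (Prod.ext ha hb)⟩

/-- The two open sets that cover the model. -/
def side (m n : ℕ) : Bool → Set (Model m n)
  | false => {p | p.1 ∈ Region m n}
  | true => {p | p.1.swap ∈ Region n m}

theorem isOpen_side (i : Bool) : IsOpen (side m n i) := by
  cases i
  · exact isOpen_Region.preimage continuous_subtype_val
  · exact isOpen_Region.preimage (continuous_swap.comp continuous_subtype_val)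

theorem exists_mem_side (p : Model m n) : ∃ i, p ∈ side m n i := by
  rcases mem_Region_or_swap p.2 with h | h
  exacts [⟨false, h⟩, ⟨true, h⟩]

theorem mem_side_of_slitForm {p : Model m n} (hp : slitForm m n p.1 ∈ slitPlane) (i : Bool) :
    p ∈ side m n i := by
  cases i
  exacts [Or.inr hp, Or.inr ((slitForm_swap_mem p.1).2 hp)]

/-- The slit region is exactly the intersection of the two sides. A point in it is reached through
the convex set of logarithms, within both sides; any other point lies on a single side, which is
path connected. -/
theorem exists_path_in_side (hm : 0 < m) (hn : 0 < n) (hco : m.Coprime n) {y : Model m n}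
    (hy : slitForm m n y.1 ∈ slitPlane) (p : Model m n) :
    ∃ η : Path y p, ∀ i, p ∈ side m n i → ∀ t, η t ∈ side m n i := by
  by_cases hp : slitForm m n p.1 ∈ slitPlane
  · obtain ⟨c, rfl⟩ := exists_expMap_eq hm hn hco hy
    obtain ⟨d, rfl⟩ := exists_expMap_eq hm hn hco hp
    have : PathConnectedSpace (LogRegion m n) :=
      isPathConnected_iff_pathConnectedSpace.1 (convex_LogRegion.isPathConnected ⟨c.1, c.2⟩)
    exact ⟨(PathConnectedSpace.somePath c d).map (expMap m n).continuous,
      fun i _ t => mem_side_of_slitForm (slitForm_expMap _) i⟩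
  rcases mem_Region_or_swap p.2 with h | h
  · obtain ⟨η, hη⟩ := exists_path_in_Region (Homeomorph.refl (Model m n)) hm hn (Or.inr hy) h
    refine ⟨η, fun i hi => ?_⟩
    cases i
    · exact hη
    · exact absurd (slitForm_mem_of_Region_of_swap h hi) hp
  · obtain ⟨η, hη⟩ := exists_path_in_Region (swapModel m n) hn hm
      (Or.inr ((slitForm_swap_mem y.1).2 hy)) h
    refine ⟨η, fun i hi => ?_⟩
    cases i
    · exact absurd (slitForm_mem_of_Region_of_swap hi h) hp
    · exact hη

theorem exists_slitForm_mem (hn : 0 < n) : ∃ y : Model m n, slitForm m n y.1 ∈ slitPlane := by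
  have hn' : (n : ℝ) ≠ 0 := by exact_mod_cast hn.ne'
  -- The arguments `π / n` and `0` put the combination at `π`, the midpoint of the allowed interval.
  have h : (((Real.pi / n : ℝ) * I, 0) : ℂ × ℂ) ∈ LogRegion m n := by
    have h1 : n * (((Real.pi / n : ℝ) : ℂ) * I).im - m * (0 : ℂ).im = Real.pi := by
      rw [im_ofReal_mul, I_im, zero_im, mul_zero, sub_zero, mul_one, mul_div_cancel₀ _ hn']
    rw [LogRegion, Set.mem_ofPred_eq, h1]
    constructor <;> linarith [Real.pi_pos]
  exact ⟨_, slitForm_expMap ⟨_, h⟩⟩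

theorem pathConnectedSpace_Model (hm : 0 < m) (hn : 0 < n) (hco : m.Coprime n) :
    PathConnectedSpace (Model m n) := by
  obtain ⟨y, hy⟩ := exists_slitForm_mem (m := m) hn
  refine pathConnectedSpace_iff_eq.2 ⟨y, Set.eq_univ_of_forall fun p => ?_⟩
  obtain ⟨η, -⟩ := exists_path_in_side hm hn hco hy p
  exact ⟨η⟩

/-- The loop in the intersection of the two sides which winds `m` times around the first
coordinate axis and `n` times around the second one. -/
theorem exists_regular_fibre (hm : 0 < m) (hn : 0 < n) (hco : m.Coprime n) {y : Model m n}
    (hy : slitForm m n y.1 ∈ slitPlane) :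
    ∃ (γ : Path y y) (a b : C(unitInterval, ℂ)), (∀ t i, γ t ∈ side m n i) ∧
      (∀ t, exp (a t) = (γ t).1.1) ∧ (∀ t, exp (b t) = (γ t).1.2) ∧
      a 1 = a 0 + (m : ℤ) * (2 * Real.pi * I) ∧ b 1 = b 0 + (n : ℤ) * (2 * Real.pi * I) := by
  obtain ⟨c, rfl⟩ := exists_expMap_eq hm hn hco hy
  let δ : C(unitInterval, LogRegion m n) :=
    ⟨fun t => ⟨(c.1.1 + ((t : ℝ) * (m * (2 * Real.pi)) : ℝ) * I,
      c.1.2 + ((t : ℝ) * (n * (2 * Real.pi)) : ℝ) * I), by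
        -- Moving the arguments at speeds proportional to `m` and `n` leaves the combination
        -- constant, as `n * m - m * n = 0`.
        have h1 : n * (c.1.1 + ((t : ℝ) * (m * (2 * Real.pi)) : ℝ) * I).im -
            m * (c.1.2 + ((t : ℝ) * (n * (2 * Real.pi)) : ℝ) * I).im =
            n * c.1.1.im - m * c.1.2.im := by
          rw [add_im, add_im, im_ofReal_mul, im_ofReal_mul, I_im]; ring
        have h2 : n * c.1.1.im - m * c.1.2.im ∈ Set.Ioo 0 (2 * Real.pi) := c.2
        rw [← h1] at h2
        exact h2⟩, by fun_prop⟩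
  have h1 : ∀ k : ℕ, exp (((1 : ℝ) * (k * (2 * Real.pi)) : ℝ) * I) = 1 := fun k => by
    rw [exp_eq_one_iff]; exact ⟨k, by push_cast; ring⟩
  refine ⟨⟨(expMap m n).comp δ, ?_, ?_⟩, ⟨fun t => (δ t).1.1, by fun_prop⟩,
    ⟨fun t => (δ t).1.2, by fun_prop⟩, fun t i => mem_side_of_slitForm (slitForm_expMap _) i,
    fun t => rfl, fun t => rfl, ?_, ?_⟩
  · refine congrArg (expMap m n) (Subtype.ext (Prod.ext ?_ ?_)) <;> simp [δ]
  · refine Subtype.ext (Prod.ext ?_ ?_)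
    · change exp (c.1.1 + ((1 : ℝ) * (m * (2 * Real.pi)) : ℝ) * I) = exp c.1.1
      rw [exp_add, h1, mul_one]
    · change exp (c.1.2 + ((1 : ℝ) * (n * (2 * Real.pi)) : ℝ) * I) = exp c.1.2
      rw [exp_add, h1, mul_one]
  · simp [δ]; ring
  · simp [δ]; ring

theorem exists_generator_side_false (hm : 0 < m) (hn : 0 < n) {y : Model m n}
    (hy : y.1 ∈ Region m n) :
    ∃ x : FundamentalGroup (Model m n) y,
      (∀ (γ : Path y y) (l : C(unitInterval, ℂ)) (k : ℤ), (∀ t, (γ t).1 ∈ Region m n) →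
        (∀ t, exp (l t) = (γ t).1.2) → l 1 = l 0 + k * (2 * Real.pi * I) →
        Path.Homotopic.Quotient.mk γ = x ^ k) ∧
      ∃ (γ : Path y y) (l : C(unitInterval, ℂ)), (∀ t, (γ t).1 ∈ Region m n) ∧
        (∀ t, exp (l t) = (γ t).1.2) ∧ l 1 = l 0 + 2 * Real.pi * I :=
  exists_region_generator (Homeomorph.refl (Model m n)) hm hn hy

theorem exists_generator_side_true (hm : 0 < m) (hn : 0 < n) {y : Model m n}
    (hy : y.1.swap ∈ Region n m) :
    ∃ x : FundamentalGroup (Model m n) y,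
      (∀ (γ : Path y y) (l : C(unitInterval, ℂ)) (k : ℤ), (∀ t, (γ t).1.swap ∈ Region n m) →
        (∀ t, exp (l t) = (γ t).1.1) → l 1 = l 0 + k * (2 * Real.pi * I) →
        Path.Homotopic.Quotient.mk γ = x ^ k) ∧
      ∃ (γ : Path y y) (l : C(unitInterval, ℂ)), (∀ t, (γ t).1.swap ∈ Region n m) ∧
        (∀ t, exp (l t) = (γ t).1.1) ∧ l 1 = l 0 + 2 * Real.pi * I :=
  exists_region_generator (swapModel m n) hn hm hy

theorem exists_log_lift_of_side_false (hm : 0 < m) {y : Model m n} (γ : Path y y)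
    (hγ : ∀ t, (γ t).1 ∈ Region m n) :
    ∃ (l : C(unitInterval, ℂ)) (k : ℤ), (∀ t, exp (l t) = (γ t).1.2) ∧
      l 1 = l 0 + k * (2 * Real.pi * I) :=
  exists_log_lift_of_Region (Homeomorph.refl (Model m n)) hm γ hγ

theorem exists_log_lift_of_side_true (hn : 0 < n) {y : Model m n} (γ : Path y y)
    (hγ : ∀ t, (γ t).1.swap ∈ Region n m) :
    ∃ (l : C(unitInterval, ℂ)) (k : ℤ), (∀ t, exp (l t) = (γ t).1.1) ∧
      l 1 = l 0 + k * (2 * Real.pi * I) :=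
  exists_log_lift_of_Region (swapModel m n) hn γ hγ

theorem closure_eq_top_of_generators (hm : 0 < m) (hn : 0 < n) (hco : m.Coprime n) {y : Model m n}
    (hy : slitForm m n y.1 ∈ slitPlane) (u v : FundamentalGroup (Model m n) y)
    (hu : ∀ γ : Path y y, (∀ t, (γ t).1 ∈ Region m n) →
      ∃ k : ℤ, FundamentalGroup.fromPath (Path.Homotopic.Quotient.mk γ) = u ^ k)
    (hv : ∀ γ : Path y y, (∀ t, (γ t).1.swap ∈ Region n m) →
      ∃ k : ℤ, FundamentalGroup.fromPath (Path.Homotopic.Quotient.mk γ) = v ^ k) :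
    Subgroup.closure {u, v} = ⊤ := by
  have hmem : ∀ w ∈ ({u, v} : Set (FundamentalGroup (Model m n) y)), ∀ (k : ℤ) g,
      g = w ^ k → g ∈ Subgroup.closure {u, v} := by
    rintro w hw k g rfl
    exact zpow_mem (Subgroup.subset_closure hw) k
  refine FundamentalGroup.eq_top_of_open_cover isOpen_side exists_mem_side
    (exists_path_in_side hm hn hco hy) _ fun i γ hγ => ?_
  cases i
  · obtain ⟨k, hk⟩ := hu γ hγ
    exact hmem u (Set.mem_insert _ _) k _ hk
  · obtain ⟨k, hk⟩ := hv γ hγ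
    exact hmem v (Set.mem_insert_of_mem _ rfl) k _ hk

/-- The fundamental group of the model has the presentation `⟨x, y | x ^ n = y ^ m⟩`. -/
theorem exists_presentation (hm : 0 < m) (hn : 0 < n) (hco : m.Coprime n) {y : Model m n}
    (hy : slitForm m n y.1 ∈ slitPlane) :
    ∃ u v : FundamentalGroup (Model m n) y, Subgroup.closure {u, v} = ⊤ ∧ u ^ n = v ^ m ∧
      ∀ (Γ : Type) [Group Γ] (A B : Γ), A ^ n = B ^ m →
        ∃ Φ : FundamentalGroup (Model m n) y →* Γ, Φ u = A ∧ Φ v = B := by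
  obtain ⟨u, hu, γu, lu, hγu, hlu, hlu'⟩ :=
    exists_generator_side_false hm hn (Or.inr hy)
  obtain ⟨v, hv, γv, lv, hγv, hlv, hlv'⟩ :=
    exists_generator_side_true hm hn (Or.inr ((slitForm_swap_mem y.1).2 hy))
  refine ⟨u, v, ?_, ?_, fun Γ _ A B hAB => ?_⟩
  · refine closure_eq_top_of_generators hm hn hco hy u v (fun γ hγ => ?_) fun γ hγ => ?_
    · obtain ⟨l, k, hl, hk⟩ := exists_log_lift_of_side_false hm γ hγ
      exact ⟨k, hu γ l k hγ hl hk⟩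
    · obtain ⟨l, k, hl, hk⟩ := exists_log_lift_of_side_true hn γ hγ
      exact ⟨k, hv γ l k hγ hl hk⟩
  -- This loop lies on both sides, so its class is at once `u ^ n` and `v ^ m`.
  · obtain ⟨γ, a, b, hγ, ha, hb, ha', hb'⟩ := exists_regular_fibre hm hn hco hy
    have h1 := hu γ b n (fun t => hγ t false) hb hb'
    have h2 := hv γ a m (fun t => hγ t true) ha ha'
    rw [zpow_natCast] at h1 h2
    exact h1.symm.trans h2
  · obtain ⟨Φ, h1, h2⟩ := exists_hom hm hn hco A B hAB y
    refine ⟨Φ, ?_, ?_⟩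
    · have := hu γu lu 1 hγu hlu (by simpa using hlu')
      rw [zpow_one] at this
      rw [← h1 γu lu hγu hlu hlu']
      exact congrArg Φ this.symm
    · have := hv γv lv 1 hγv hlv (by simpa using hlv')
      rw [zpow_one] at this
      rw [← h2 γv lv hγv hlv hlv']
      exact congrArg Φ this.symm

end TorusModel

/-! ### The knot complement as a retract of the model -/

theorem FundamentalGroup.map_injective_of_leftInverse {X Y : Type*} [TopologicalSpace X]
    [TopologicalSpace Y] (i : C(X, Y)) (r : C(Y, X)) (h : ∀ x, r (i x) = x) (x : X) :
    Function.Injective (FundamentalGroup.map i x) := by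
  rw [injective_iff_map_eq_one]
  intro g hg
  induction g using Path.Homotopic.Quotient.ind with
  | mk γ =>
  have h1 : Path.Homotopic.Quotient.mk (γ.map i.continuous) =
      Path.Homotopic.Quotient.mk (Path.refl (i x)) := hg
  have h2 := ((Path.Homotopic.Quotient.exact h1).map r).pathCast (h x).symm (h x).symm
  have h3 : ((γ.map i.continuous).map r.continuous).cast (h x).symm (h x).symm = γ :=
    Path.ext (funext fun t => h (γ t))
  have h4 : ((Path.refl (i x)).map r.continuous).cast (h x).symm (h x).symm = Path.refl x :=
    Path.ext (funext fun t => h x)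
  rw [h3, h4] at h2
  exact Path.Homotopic.Quotient.eq.2 h2

namespace GenTorsion

open Complex TorusModel

theorem eqnSpectrum_subset_map {G H : Type*} [Group G] [Group H] (f : G →* H) (g : G) :
    eqnSpectrum g ⊆ eqnSpectrum (f g) := by
  rintro N ⟨hN, x, hx⟩
  refine ⟨hN, fun i => f (x i), ?_⟩
  rw [← map_one f, ← hx, map_list_prod, List.map_ofFn]
  congr 2
  funext i
  simp

theorem mem_eqnSpectrum_of_gord_eq {G : Type*} [Group G] {g : G} {k : ℕ}
    (hne : (eqnSpectrum g).Nonempty) (hk : gord g = k) : k ∈ eqnSpectrum g := by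
  have h : gord g = (sInf (eqnSpectrum g) : ℕ) := by
    refine le_antisymm (iInf₂_le _ (Nat.sInf_mem hne)) (le_iInf₂ fun N hN => ?_)
    exact_mod_cast Nat.sInf_le hN
  rw [hk] at h
  have : k = sInf (eqnSpectrum g) := by exact_mod_cast h
  exact this ▸ Nat.sInf_mem hne

/-- A circle-valued version of the parametrisation of the curve `u ^ n = v ^ m`. -/
theorem exists_pow_eq_of_pow_eq {G : Type*} [CommGroup G] {m n : ℕ} (hco : m.Coprime n) {u v : G}
    (h : u ^ n = v ^ m) : ∃ w : G, w ^ m = u ∧ w ^ n = v := by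
  have hbez : (1 : ℤ) = m * m.gcdA n + n * m.gcdB n := by
    have := Nat.gcd_eq_gcd_ab m n
    rw [hco.gcd_eq_one] at this
    exact_mod_cast this
  refine ⟨u ^ m.gcdA n * v ^ m.gcdB n, ?_, ?_⟩
  · have h1 : (v ^ m.gcdB n) ^ m = (u ^ n) ^ m.gcdB n := by
      rw [h, ← zpow_natCast, ← zpow_natCast, ← zpow_mul, ← zpow_mul, mul_comm]
    rw [mul_pow, h1, ← zpow_natCast, ← zpow_natCast, ← zpow_mul, ← zpow_mul, ← zpow_add,
      mul_comm _ (m : ℤ), ← hbez, zpow_one]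
  · have h1 : (u ^ m.gcdA n) ^ n = (v ^ m) ^ m.gcdA n := by
      rw [← h, ← zpow_natCast, ← zpow_natCast, ← zpow_mul, ← zpow_mul, mul_comm]
    rw [mul_pow, h1, ← zpow_natCast, ← zpow_natCast, ← zpow_mul, ← zpow_mul, ← zpow_add,
      mul_comm _ (n : ℤ), ← hbez, zpow_one]

/-- The pair of coordinates of a point of `S³`. -/
def coords (z : S3) : ℂ × ℂ := (z.1 0, z.1 1)

theorem continuous_coords : Continuous coords := by
  unfold coords
  fun_prop

theorem norm_sq_add_norm_sq (z : S3) : ‖(coords z).1‖ ^ 2 + ‖(coords z).2‖ ^ 2 = 1 := by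
  have h := z.2
  rw [mem_sphere_zero_iff_norm, EuclideanSpace.norm_eq, Real.sqrt_eq_one, Fin.sum_univ_two] at h
  exact h

theorem coords_injective : Function.Injective coords := by
  intro z w h
  refine Subtype.ext (PiLp.ext fun i => ?_)
  fin_cases i
  exacts [congrArg Prod.fst h, congrArg Prod.snd h]

theorem coords_torusCurve (m n : ℕ) (z : Circle) :
    coords (torusCurve m n z) = ((z : ℂ) ^ m / (√2 : ℝ), (z : ℂ) ^ n / (√2 : ℝ)) := rfl

/-- On the cone over the knot the phases `z ^ (m * n)` and its conjugate cancel, so the form is a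
nonpositive real number. -/
theorem slitForm_torusCurve (m n : ℕ) (z : Circle) (r : ℝ) (hr : 0 ≤ r) :
    slitForm m n (r * (coords (torusCurve m n z)).1, r * (coords (torusCurve m n z)).2) ∉
      slitPlane := by
  have h : slitForm m n (r * (coords (torusCurve m n z)).1, r * (coords (torusCurve m n z)).2) =
      -(((r / √2) ^ (n + m) : ℝ) : ℂ) := by
    have hz : (z : ℂ) * (starRingEnd ℂ) z = 1 := by
      rw [mul_conj, Circle.normSq_coe, ofReal_one]
    have hz' : ((z : ℂ) ^ m) ^ n * ((starRingEnd ℂ) (z : ℂ) ^ n) ^ m = 1 := by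
      rw [← pow_mul, ← pow_mul, mul_comm n m, ← mul_pow, hz, one_pow]
    rw [slitForm, coords_torusCurve]
    simp only [map_mul, map_div₀, map_pow, conj_ofReal, mul_pow, div_pow]
    push_cast
    rw [pow_add, pow_add]
    congr 1
    calc _ = (r : ℂ) ^ n * r ^ m / ((√2 : ℝ) ^ n * (√2 : ℝ) ^ m) *
        (((z : ℂ) ^ m) ^ n * ((starRingEnd ℂ) (z : ℂ) ^ n) ^ m) := by ring
      _ = _ := by rw [hz', mul_one]
  rw [h, neg_ofReal_mem_slitPlane, not_lt]
  positivity

open scoped ComplexOrder in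
theorem mem_standardTorusKnot_or_mem_Model {m n : ℕ} (hco : m.Coprime n) (z : S3) :
    z ∈ standardTorusKnot m n ∨ coords z ∈ Model m n := by
  rw [or_iff_not_imp_right]
  intro hz
  simp only [Model, Set.mem_ofPred_eq, not_or, not_lt] at hz
  obtain ⟨h1, h2, h3⟩ := hz
  have heq := le_antisymm h2 h1
  have hsq := norm_sq_add_norm_sq z
  have h2pos : (0 : ℝ) < √2 := Real.sqrt_pos.2 two_pos
  have hn1 : √2 * ‖(coords z).1‖ = 1 := by
    have : (√2 * ‖(coords z).1‖) ^ 2 = 1 := by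
      rw [mul_pow, Real.sq_sqrt zero_le_two]
      rw [← heq] at hsq
      linarith
    exact (pow_eq_one_iff_of_nonneg (by positivity) two_ne_zero).1 this
  have hn2 : √2 * ‖(coords z).2‖ = 1 := by rw [← heq]; exact hn1
  let u : Circle := ⟨(√2 : ℝ) * (coords z).1,
    mem_sphere_zero_iff_norm.2 (by rw [norm_mul, norm_real, Real.norm_of_nonneg h2pos.le, hn1])⟩
  let v : Circle := ⟨(√2 : ℝ) * (coords z).2,
    mem_sphere_zero_iff_norm.2 (by rw [norm_mul, norm_real, Real.norm_of_nonneg h2pos.le, hn2])⟩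
  -- Outside the model both coordinates have modulus `1 / √2`. The number `u ^ n * conj v ^ m` is
  -- then real, nonnegative and of modulus one, hence equal to `1`.
  have huv : u ^ n = v ^ m := by
    have h4 : (u : ℂ) ^ n * (starRingEnd ℂ) (v : ℂ) ^ m =
        ((√2 ^ (n + m) : ℝ) : ℂ) * -slitForm m n (coords z) := by
      change ((√2 : ℝ) * (coords z).1) ^ n * (starRingEnd ℂ) ((√2 : ℝ) * (coords z).2) ^ m = _
      rw [slitForm, neg_neg, map_mul, conj_ofReal, mul_pow, mul_pow, pow_add]
      push_cast
      ring
    have h5 : slitForm m n (coords z) ≤ 0 := by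
      by_contra hlt
      exact h3 (mem_slitPlane_iff_not_le_zero.2 hlt)
    obtain ⟨h6, h7⟩ := Complex.le_def.1 h5
    have h8 : (u : ℂ) ^ n * (starRingEnd ℂ) (v : ℂ) ^ m =
        ((√2 ^ (n + m) * -(slitForm m n (coords z)).re : ℝ) : ℂ) := by
      rw [h4]
      apply Complex.ext
      · rw [re_ofReal_mul, ofReal_re, neg_re]
      · rw [im_ofReal_mul, ofReal_im, neg_im, h7]; simp
    set s := √2 ^ (n + m) * -(slitForm m n (coords z)).re with hs
    have hs0 : 0 ≤ s := mul_nonneg (by positivity) (by simpa using h6)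
    have hs1 : s = 1 := by
      have := congrArg norm h8
      rw [norm_mul, norm_pow, norm_pow, Circle.norm_coe, norm_conj, Circle.norm_coe, one_pow,
        one_pow, one_mul, norm_real, Real.norm_of_nonneg hs0] at this
      exact this.symm
    rw [hs1, ← Circle.coe_inv_eq_conj, ← Circle.coe_pow, ← Circle.coe_pow, ← Circle.coe_mul,
      ofReal_one, Circle.coe_eq_one, inv_pow, mul_inv_eq_one] at h8
    exact h8
  obtain ⟨w, hw1, hw2⟩ := exists_pow_eq_of_pow_eq hco huv
  have h20 : ((√2 : ℝ) : ℂ) ≠ 0 := by exact_mod_cast h2pos.ne'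
  refine ⟨w, coords_injective ?_⟩
  rw [coords_torusCurve, ← Circle.coe_pow, ← Circle.coe_pow, hw1, hw2]
  exact Prod.ext (mul_div_cancel_left₀ _ h20) (mul_div_cancel_left₀ _ h20)

theorem ne_zero_of_mem_Model {m n : ℕ} (hm : 0 < m) {z : ℂ × ℂ} (hz : z ∈ Model m n) :
    !₂[z.1, z.2] ≠ 0 := by
  intro h
  have h1 : z.1 = 0 := congrFun (congrArg WithLp.ofLp h) 0
  have h2 : z.2 = 0 := congrFun (congrArg WithLp.ofLp h) 1
  rcases hz with h | h | h
  · simp [h1, h2] at h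
  · simp [h1, h2] at h
  · exact snd_ne_zero_of_slitForm hm h h2

/-- Radial projection of the model to the sphere. -/
noncomputable def toSphere {m n : ℕ} (hm : 0 < m) (z : Model m n) : S3 :=
  ⟨(‖!₂[z.1.1, z.1.2]‖⁻¹ : ℝ) • !₂[z.1.1, z.1.2], by
    rw [mem_sphere_zero_iff_norm, norm_smul, norm_inv, norm_norm,
      inv_mul_cancel₀ (norm_ne_zero_iff.2 (ne_zero_of_mem_Model hm z.2))]⟩

theorem continuous_toSphere {m n : ℕ} (hm : 0 < m) :
    Continuous (toSphere (m := m) (n := n) hm) := by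
  have h : Continuous fun z : Model m n => !₂[z.1.1, z.1.2] := by fun_prop
  refine Continuous.subtype_mk ?_ _
  exact (h.norm.inv₀ fun z => norm_ne_zero_iff.2 (ne_zero_of_mem_Model hm z.2)).smul h

/-- A point whose projection is on the knot lies on the cone over it: its coordinates have equal
norms and the form avoids the slit plane, against each clause defining the model. -/
theorem toSphere_notMem {m n : ℕ} (hm : 0 < m) (z : Model m n) :
    toSphere hm z ∉ standardTorusKnot m n := by
  rintro ⟨w, hw⟩
  set r := ‖!₂[z.1.1, z.1.2]‖ with hr
  have hr0 : r ≠ 0 := norm_ne_zero_iff.2 (ne_zero_of_mem_Model hm z.2)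
  have hc : coords (torusCurve m n w) = ((r⁻¹ : ℝ) * z.1.1, (r⁻¹ : ℝ) * z.1.2) := by
    rw [hw]
    refine Prod.ext ?_ ?_ <;> simp [coords, toSphere, hr]
  have hz : z.1 = (r * (coords (torusCurve m n w)).1, r * (coords (torusCurve m n w)).2) := by
    have hrc : (r : ℂ) ≠ 0 := by exact_mod_cast hr0
    rw [hc]
    refine Prod.ext ?_ ?_ <;> (push_cast; field_simp)
  have hnorm : ‖z.1.1‖ = ‖z.1.2‖ := by
    rw [hz, coords_torusCurve, norm_mul, norm_mul, norm_div, norm_div, norm_pow, norm_pow,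
      Circle.norm_coe, one_pow, one_pow]
  rcases z.2 with h | h | h
  · exact h.ne hnorm
  · exact h.ne hnorm.symm
  · rw [hz] at h
    exact slitForm_torusCurve m n w r (norm_nonneg _) h

theorem coords_mem_Model {m n : ℕ} (hco : m.Coprime n) {K : Set S3} {h : S3 ≃ₜ S3}
    (hK : h '' standardTorusKnot m n = K) (x : (Kᶜ : Set S3)) :
    coords (h.symm x.1) ∈ Model m n := by
  refine (mem_standardTorusKnot_or_mem_Model hco _).resolve_left fun hmem => x.2 ?_
  exact hK.subset ⟨_, hmem, h.apply_symm_apply _⟩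

/-- The knot group of a torus knot embeds in the fundamental group of the model. -/
theorem exists_injective_hom {m n : ℕ} (hm : 0 < m) (hco : m.Coprime n) {K : Set S3}
    (hK : IsTorusKnot m n K) (x₀ : (Kᶜ : Set S3)) :
    ∃ (y : Model m n) (f : KnotGroup K x₀ →* FundamentalGroup (Model m n) y),
      Function.Injective f := by
  obtain ⟨h, hK⟩ := hK
  let i : C((Kᶜ : Set S3), Model m n) :=
    ⟨fun x => ⟨coords (h.symm x.1), coords_mem_Model hco hK x⟩,
      (continuous_coords.comp (h.symm.continuous.comp continuous_subtype_val)).subtype_mk _⟩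
  have hr (z : Model m n) : h (toSphere hm z) ∈ Kᶜ := by
    rw [← hK, Set.mem_compl_iff, h.injective.mem_set_image]
    exact toSphere_notMem hm z
  let r : C(Model m n, (Kᶜ : Set S3)) :=
    ⟨fun z => ⟨h (toSphere hm z), hr z⟩,
      (h.continuous.comp (continuous_toSphere hm)).subtype_mk hr⟩
  refine ⟨i x₀, FundamentalGroup.map i x₀,
    FundamentalGroup.map_injective_of_leftInverse i r (fun x => ?_) x₀⟩
  refine Subtype.ext ?_
  change h (toSphere hm (i x)) = x.1
  have hv : !₂[(i x).1.1, (i x).1.2] = (h.symm x.1).1 := by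
    refine PiLp.ext fun j => ?_
    fin_cases j <;> rfl
  -- Radial projection fixes the unit sphere, so `r` is a left inverse of `i`.
  have : toSphere hm (i x) = h.symm x.1 := by
    refine Subtype.ext ?_
    change (‖!₂[(i x).1.1, (i x).1.2]‖⁻¹ : ℝ) • !₂[(i x).1.1, (i x).1.2] = (h.symm x.1).1
    rw [hv, mem_sphere_zero_iff_norm.1 (h.symm x.1).2, inv_one, one_smul]
  rw [this, h.apply_symm_apply]

theorem eqnSpectrum_knotGroup_subset {p q a b : ℕ} (hp : p.Prime) (hq : q.Prime) (hpq : p < q)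
    {K : Set S3} (hK : IsTorusKnot (p ^ a) (q ^ b) K) (x₀ : (Kᶜ : Set S3)) (g : KnotGroup K x₀)
    (hg : g ≠ 1) : eqnSpectrum g ⊆ {n : ℕ | p ∣ n} ∪ {n : ℕ | q ≤ n} := by
  have hm : 0 < p ^ a := pow_pos hp.pos a
  have hn : 0 < q ^ b := pow_pos hq.pos b
  have hco : (p ^ a).Coprime (q ^ b) := Nat.coprime_pow_primes a b hp hq hpq.ne
  -- The spectrum grows along `f` and along the change of base point `e`; injectivity is needed only
  -- to keep the image of `g` nontrivial. The presentation is available at a base point `y'` in the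
  -- slit region, which `y` need not be.
  obtain ⟨y, f, hf⟩ := exists_injective_hom hm hco hK x₀
  have := pathConnectedSpace_Model hm hn hco
  obtain ⟨y', hy'⟩ := exists_slitForm_mem (m := p ^ a) hn
  obtain ⟨u, v, hgen, hrel, hlift⟩ := exists_presentation hm hn hco hy'
  let e := FundamentalGroup.fundamentalGroupMulEquivOfPathConnected y y'
  refine ((eqnSpectrum_subset_map f g).trans (eqnSpectrum_subset_map e.toMonoidHom (f g))).trans
    (TorusGroup.eqnSpectrum_subset hp hq hpq.ne (mul_comm (q ^ b) (p ^ a)) hgen hrel hlift ?_)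
  intro h1
  refine hg (hf (e.injective ?_))
  rw [map_one f, map_one e]
  exact h1

end GenTorsion

theorem mainTheorem5 (p q a b : ℕ) (hp : p.Prime) (hq : q.Prime) (hpq : p < q)
    (K : Set GenTorsion.S3) (hK : GenTorsion.IsTorusKnot (p ^ a) (q ^ b) K)
    (x₀ : (Kᶜ : Set GenTorsion.S3)) :
    (∀ g : GenTorsion.KnotGroup K x₀, g ≠ 1 →
      GenTorsion.eqnSpectrum g ⊆ {n : ℕ | p ∣ n} ∪ {n : ℕ | q ≤ n}) ∧
    ¬ ∃ (g : GenTorsion.KnotGroup K x₀) (k : ℕ),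
      GenTorsion.IsGeneralizedTorsion g ∧ GenTorsion.gord g = k ∧ k < q ∧ ¬ p ∣ k := by
  have main := GenTorsion.eqnSpectrum_knotGroup_subset hp hq hpq hK x₀
  refine ⟨main, ?_⟩
  rintro ⟨g, k, ⟨hg, hne⟩, hk, hkq, hpk⟩
  rcases main g hg (GenTorsion.mem_eqnSpectrum_of_gord_eq hne hk) with h | h
  · exact hpk h
  · exact absurd hkq (not_lt.2 h)
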